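/- Let $N\ge 2$ and let $w=(w_{ij})$ be the nonnegative symmetric weight matrix of a connected undirected graph on $\{1,\dots,N\}$ ($w_{ij}>0$ iff $\{i,j\}$ is an edge; the unweighted case is $w_{ij}\in\{0,1\}$). Let $L=D-w$ be its Laplacian, with $D$ diagonal, $d_i=\sum_j w_{ij}$. For $\gamma>0$ put $$\Gamma=\begin{bmatrix}0&I_N\\-L&-\gamma L\end{bmatrix},$$ order the complex eigenvalues of $\Gamma$, with algebraic multiplicity, by decreasing real part, and write $\lambda_3(\Gamma)$ for the absolute value of the real part of the third one. Agent $i$ has position $r_i$ and velocity $v_i$ with $\dot r_i=v_i$, $\dot v_i=u_i$. It broadcasts $(r_i,v_i)$ at its event times $0=t_0^i<t_1^i<\dots$ (finitely or infinitely many). If at time $t$ the latest event of each agent $j$ is at time $t^j_{\ell_j}$, write $$\hat v_j=v_j(t^j_{\ell_j}),\quad p_j(t)=r_j(t^j_{\ell_j})+(t-t^j_{\ell_j})\hat v_j,\quad u_i(t)=-\sum_{j}w_{ij}\bigl(p_i(t)-p_j(t)+\gamma(\hat v_i-\hat v_j)\bigr).$$ Let $e_{r,i}=p_i-r_i$, $e_{v,i}=\hat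 v_i-v_i$. The next event of agent $i$ is the first time, if any, at which $$\bigl\|(e_{r,i}(t),\gamma e_{v,i}(t))\bigr\|=c_0+c_1e^{-\alpha t},$$ where $\alpha\in\mathbb R$, $c_0,c_1\ge0$ and $c_0+c_1>0$. A trajectory is a solution of this closed loop on $[0,T^*)$, where $T^*\in(0,\infty]$ is the first accumulation point of event times of some agent ($T^*=\infty$ if there is none); $r_i,v_i$ are continuous and the velocity equation is understood with right derivatives, since $u_i$ jumps at events. The trajectory is Zeno if some agent has infinitely many events in a bounded time interval. Let $\bar r,\bar v$ be the averages of the initial positions and velocities and $$\delta(t)=\bigl((r_i(t)-\bar r-t\bar v)_{i},\,(v_i(t)-\bar v)_{i}\bigr)\in\mathbb R^{2N}.$$ (1) There is a constant $c_V>0$ depending only on the (weighted) graph such that, for all $\gamma>0$, all $c_0,c_1\ge 0$ with $c_0+c_1>0$ and all $\alpha>0$, every non-Zeno trajectory satisfies $$\limsup_{t\to\infty}\|\delta(t)\|\le \frac{\|L\|\sqrt{2N}\,c_0\,c_V}{\lambda_3(\Gamma)},$$ with Euclidean norm of $\delta$ and spectral norm of $L$. (2) If $c_0>0$ or $0<\alpha<\lambda_3(\Gamma)$,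 then no trajectory is Zeno. -/

import Mathlib

open Filter

noncomputable section

namespace DoubleIntegrator

/-- `w` is the weight matrix of a connected, undirected, weighted graph: `w i j` is the weight of
the edge between `i` and `j`, and it is positive exactly when the edge is present. -/
structure IsConnectedUndirected {N : ℕ} (w : Matrix (Fin N) (Fin N) ℝ) : Prop where
  nonneg : ∀ i j, 0 ≤ w i j
  symm : ∀ i j, w i j = w j i
  connected : (SimpleGraph.fromRel fun i j => 0 < w i j).Connected

/-- The weighted graph Laplacian `L = D - W`. -/
def laplacian {N : ℕ} (w : Matrix (Fin N) (Fin N) ℝ) : Matrix (Fin N) (Fin N) ℝ :=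
  Matrix.diagonal (fun i => ∑ j, w i j) - w

/-- The matrix `Γ = [0, I; -L, -γ L]`. -/
def Gam {N : ℕ} (γ : ℝ) (L : Matrix (Fin N) (Fin N) ℝ) :
    Matrix (Fin N ⊕ Fin N) (Fin N ⊕ Fin N) ℝ :=
  Matrix.fromBlocks 0 1 (-L) (-(γ • L))

/-- List the complex eigenvalues of `A`, with algebraic multiplicity, by decreasing real part
`Re λ₁ ≥ Re λ₂ ≥ Re λ₃ ≥ …`; this is `|Re λ₃|`. -/
def absReLambda3 {n : Type*} [Fintype n] [DecidableEq n] (A : Matrix n n ℝ) : ℝ :=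
  |(((A.map Complex.ofReal).charpoly.roots.map Complex.re).sort (· ≥ ·)).getD 2 0|

/-- The spectral norm (operator norm for the Euclidean norm) of a matrix. -/
def specNorm {N : ℕ} (L : Matrix (Fin N) (Fin N) ℝ) : ℝ :=
  ‖Matrix.toEuclideanCLM (n := Fin N) (𝕜 := ℝ) L‖

/-- The data of an execution: positions, velocities and, for every agent, its sequence of event
times, where the value `⊤` of `event i ℓ` means that agent `i` has no `ℓ`-th event. -/
structure Execution (N : ℕ) where
  r : Fin N → ℝ → ℝ
  v : Fin N → ℝ → ℝ
  event : Fin N → ℕ → EReal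

namespace Execution

variable {N : ℕ} (x : Execution N)

/-- The end of the time interval `[0, horizon)` on which the closed loop is defined: the first
accumulation time of the events of some agent, and `⊤` if there is none. -/
def horizon : EReal := ⨅ i, ⨆ ℓ, x.event i ℓ

/-- Some agent has infinitely many events in bounded time. -/
def IsZeno : Prop := ∃ i, ∃ T : ℝ, 0 < T ∧ ∀ ℓ, x.event i ℓ ≤ (T : EReal)

/-- The `ℓ`-th event time of agent `i` as a real number (used only where it is finite). -/
def eventTime (i : Fin N) (ℓ : ℕ) : ℝ := (x.event i ℓ).toReal

/-- First-order hold of the position broadcast by agent `i` at its `ℓ`-th event: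
`r i t_ℓ + (s - t_ℓ) v i t_ℓ`. -/
def holdR (i : Fin N) (ℓ : ℕ) (s : ℝ) : ℝ :=
  x.r i (x.eventTime i ℓ) + (s - x.eventTime i ℓ) * x.v i (x.eventTime i ℓ)

/-- The velocity broadcast by agent `i` at its `ℓ`-th event. -/
def holdV (i : Fin N) (ℓ : ℕ) : ℝ := x.v i (x.eventTime i ℓ)

/-- The position error at time `s` relative to the `ℓ`-th broadcast. -/
def errR (i : Fin N) (ℓ : ℕ) (s : ℝ) : ℝ := x.holdR i ℓ s - x.r i s

/-- The velocity error at time `s` relative to the `ℓ`-th broadcast. -/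
def errV (i : Fin N) (ℓ : ℕ) (s : ℝ) : ℝ := x.holdV i ℓ - x.v i s

/-- The input of agent `i` at time `s`, when the latest event of each agent `j` is number `k j`. -/
def control (w : Matrix (Fin N) (Fin N) ℝ) (γ : ℝ) (k : Fin N → ℕ) (i : Fin N) (s : ℝ) : ℝ :=
  -∑ j, w i j * (x.holdR i (k i) s - x.holdR j (k j) s + γ * (x.holdV i (k i) - x.holdV j (k j)))

/-- The trigger function `‖(e_r, γ e_v)‖ - (c₀ + c₁ exp (-α s))` of agent `i` at time `s`, for the
errors relative to its `ℓ`-th broadcast. -/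
def trigger (γ c₀ c₁ α : ℝ) (i : Fin N) (ℓ : ℕ) (s : ℝ) : ℝ :=
  ‖!₂[x.errR i ℓ s, γ * x.errV i ℓ s]‖ - (c₀ + c₁ * Real.exp (-α * s))

/-- `x` is a trajectory of the event-triggered closed loop. The input is only piecewise continuous,
so the velocity equation is required in the sense of a continuous function whose right derivative
at every time is the current (right-continuous) input. -/
structure IsTrajectory (w : Matrix (Fin N) (Fin N) ℝ) (γ c₀ c₁ α : ℝ) : Prop where
  event_zero : ∀ i, x.event i 0 = 0
  /-- The next event is the first time, if any, at which the trigger function vanishes. -/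
  event_succ : ∀ i ℓ, x.event i (ℓ + 1) =
    sInf ((fun s : ℝ => (s : EReal)) ''
      {s : ℝ | x.event i ℓ ≤ (s : EReal) ∧ (s : EReal) < x.horizon ∧
        x.trigger γ c₀ c₁ α i ℓ s = 0})
  cont_r : ∀ i, ContinuousOn (x.r i) {s : ℝ | 0 ≤ s ∧ (s : EReal) < x.horizon}
  cont_v : ∀ i, ContinuousOn (x.v i) {s : ℝ | 0 ≤ s ∧ (s : EReal) < x.horizon}
  deriv_r : ∀ i, ∀ s : ℝ, 0 ≤ s → (s : EReal) < x.horizon →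
    HasDerivWithinAt (x.r i) (x.v i s) (Set.Ici s) s
  deriv_v : ∀ i, ∀ s : ℝ, 0 ≤ s → (s : EReal) < x.horizon → ∀ k : Fin N → ℕ,
    (∀ j, x.event j (k j) ≤ (s : EReal) ∧ (s : EReal) < x.event j (k j + 1)) →
    HasDerivWithinAt (x.v i) (x.control w γ k i s) (Set.Ici s) s

/-- The average `N⁻¹ ∑ i, r i 0` of the initial positions. -/
def meanR : ℝ := (∑ i, x.r i 0) / N

/-- The average `N⁻¹ ∑ i, v i 0` of the initial velocities. -/
def meanV : ℝ := (∑ i, x.v i 0) / N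

/-- The disagreement vector in `ℝ^(2N)`: the state minus the consensus trajectory
`(r̄ + s v̄, v̄)` determined by the averages of the initial positions and velocities. -/
def disagreement (s : ℝ) : EuclideanSpace ℝ (Fin N ⊕ Fin N) :=
  WithLp.toLp 2 (Sum.elim (fun i => x.r i s - (x.meanR + s * x.meanV))
    (fun i => x.v i s - x.meanV))

end Execution

end DoubleIntegrator

end

/-! Write `X`, `Y` for the position and velocity disagreements and `f` for the vector of combined
errors `e_r + γ e_v`. Between events the trigger keeps each error pair below the threshold, so the
closed loop is the linear system `X' = Y`, `Y' = -L (X + γ Y + f)` with `f j ^ 2 ≤ 2 (c₀ + c₁ exp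
(-α s)) ^ 2`. Since `L` annihilates constants and is symmetric, both disagreements keep sum zero,
where `L ≥ μ > 0` (`exists_spectral_gap`).

For the ultimate bound, `V = |Y|² + X·LX + 2ε X·Y` satisfies `V' ≤ -(ε/2) V + 5 ‖L‖² |f|² / ε`
whenever `ε ≤ min (γμ, 1/γ) / 2` (`lyapunov_deriv_le`), so the disagreement is ultimately at most a
graph constant times `‖L‖ √(2N) c₀ / ε`. It remains to compare `ε` with `λ₃`. The characteristic
polynomial of `Γ` is the product of `X² + γ μ_k X + μ_k` over the Laplacian eigenvalues, and one
nonzero eigenvalue `ν` already gives `λ₃ ≤ min (γν/2, 2/γ)` (`absReLambda3_Gam`). Hence `λ₃` is at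
most a graph constant times the largest admissible `ε`, uniformly in `γ`.

For Zeno behaviour, Grönwall bounds velocities and inputs on any bounded time interval. Errors
restart from zero at each event and grow at a bounded rate, while the threshold has a positive
minimum there; events are therefore uniformly separated (`not_isZeno`). -/

noncomputable section

namespace DoubleIntegrator

open Matrix

/-! ### Laplacian: quadratic form, spectral gap, simplicity of the eigenvalue zero. -/

section Laplacian

variable {N : ℕ} {w : Matrix (Fin N) (Fin N) ℝ}

lemma laplacian_mulVec (w : Matrix (Fin N) (Fin N) ℝ) (x : Fin N → ℝ) (i : Fin N) :
    (laplacian w *ᵥ x) i = ∑ j, w i j * (x i - x j) := by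
  rw [laplacian, sub_mulVec, Pi.sub_apply, mulVec_diagonal]
  simp only [mulVec, dotProduct, mul_sub, Finset.sum_sub_distrib, Finset.sum_mul]

lemma laplacian_isHermitian (hw : IsConnectedUndirected w) : (laplacian w).IsHermitian := by
  ext i j
  rcases eq_or_ne i j with rfl | h
  · simp [laplacian]
  · simp [laplacian, diagonal_apply_ne _ h, diagonal_apply_ne _ h.symm, hw.symm j i]

lemma dotProduct_laplacian_mulVec_comm (hw : IsConnectedUndirected w) (x y : Fin N → ℝ) :
    x ⬝ᵥ laplacian w *ᵥ y = y ⬝ᵥ laplacian w *ᵥ x := by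
  have h : (laplacian w)ᵀ = laplacian w := by
    rw [← conjTranspose_eq_transpose_of_trivial]
    exact laplacian_isHermitian hw
  rw [dotProduct_mulVec, ← mulVec_transpose, h, dotProduct_comm]

lemma two_mul_dotProduct_laplacian_mulVec (hw : IsConnectedUndirected w) (x : Fin N → ℝ) :
    2 * (x ⬝ᵥ laplacian w *ᵥ x) = ∑ i, ∑ j, w i j * (x i - x j) ^ 2 := by
  have h1 : x ⬝ᵥ laplacian w *ᵥ x = ∑ i, ∑ j, w i j * (x i * (x i - x j)) := by
    simp only [dotProduct, laplacian_mulVec, Finset.mul_sum]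
    exact Finset.sum_congr rfl fun i _ => Finset.sum_congr rfl fun j _ => by ring
  have h2 : x ⬝ᵥ laplacian w *ᵥ x = ∑ i, ∑ j, w i j * (x j * (x j - x i)) := by
    rw [h1, Finset.sum_comm]
    exact Finset.sum_congr rfl fun i _ => Finset.sum_congr rfl fun j _ => by rw [hw.symm]
  rw [two_mul]
  nth_rewrite 1 [h1]
  rw [h2, ← Finset.sum_add_distrib]
  refine Finset.sum_congr rfl fun i _ => ?_
  rw [← Finset.sum_add_distrib]
  exact Finset.sum_congr rfl fun j _ => by ring

lemma dotProduct_laplacian_mulVec_nonneg (hw : IsConnectedUndirected w) (x : Fin N → ℝ) :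
    0 ≤ x ⬝ᵥ laplacian w *ᵥ x := by
  have := two_mul_dotProduct_laplacian_mulVec hw x
  have : 0 ≤ ∑ i, ∑ j, w i j * (x i - x j) ^ 2 :=
    Finset.sum_nonneg fun i _ => Finset.sum_nonneg fun j _ =>
      mul_nonneg (hw.nonneg i j) (sq_nonneg _)
  linarith

lemma eq_of_dotProduct_laplacian_mulVec_eq_zero (hw : IsConnectedUndirected w) {x : Fin N → ℝ}
    (hx : x ⬝ᵥ laplacian w *ᵥ x = 0) (i j : Fin N) : x i = x j := by
  have h := two_mul_dotProduct_laplacian_mulVec hw x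
  rw [hx, mul_zero] at h
  have hnn : ∀ i j, 0 ≤ w i j * (x i - x j) ^ 2 := fun i j =>
    mul_nonneg (hw.nonneg i j) (sq_nonneg _)
  have hz : ∀ i j, w i j * (x i - x j) ^ 2 = 0 := by
    intro i j
    have h1 := (Finset.sum_eq_zero_iff_of_nonneg
      (fun i _ => Finset.sum_nonneg fun j _ => hnn i j)).1 h.symm i (Finset.mem_univ i)
    exact (Finset.sum_eq_zero_iff_of_nonneg (fun j _ => hnn i j)).1 h1 j (Finset.mem_univ j)
  have hadj : ∀ i j, (SimpleGraph.fromRel fun i j => 0 < w i j).Adj i j → x i = x j := by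
    intro i j hij
    have hpos : 0 < w i j := by
      rcases (SimpleGraph.fromRel_adj _ _ _).1 hij with ⟨-, h | h⟩
      · exact h
      · exact hw.symm i j ▸ h
    have := (mul_eq_zero.1 (hz i j)).resolve_left hpos.ne'
    exact sub_eq_zero.1 (pow_eq_zero_iff two_ne_zero |>.1 this)
  obtain ⟨p⟩ := hw.connected.preconnected i j
  induction p with
  | nil => rfl
  | cons h _ ih => exact (hadj _ _ h).trans ih

lemma laplacian_mulVec_const (w : Matrix (Fin N) (Fin N) ℝ) (c : ℝ) :
    laplacian w *ᵥ (fun _ => c) = 0 := by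
  ext i
  simp [laplacian_mulVec]

lemma sum_laplacian_mulVec (hw : IsConnectedUndirected w) (x : Fin N → ℝ) :
    ∑ i, (laplacian w *ᵥ x) i = 0 := by
  have h := dotProduct_laplacian_mulVec_comm hw (fun _ => 1) x
  rw [laplacian_mulVec_const, dotProduct_zero] at h
  simpa [dotProduct] using h

/-- The gap is the minimum of the quadratic form over the compact unit sphere of zero-sum vectors.
It is positive because, by connectedness, the form vanishes only on constants. -/
lemma exists_spectral_gap (hw : IsConnectedUndirected w) :
    ∃ μ : ℝ, 0 < μ ∧ ∀ x : Fin N → ℝ, ∑ i, x i = 0 →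
      μ * (x ⬝ᵥ x) ≤ x ⬝ᵥ laplacian w *ᵥ x := by
  let q : (Fin N → ℝ) → ℝ := fun x => x ⬝ᵥ laplacian w *ᵥ x
  have hq : Continuous q := by
    simp only [q, dotProduct, mulVec]
    fun_prop
  let K : Set (Fin N → ℝ) := {x | ∑ i, x i = 0 ∧ x ⬝ᵥ x = 1}
  have hK : IsCompact K := by
    refine Metric.isCompact_of_isClosed_isBounded ?_ ?_
    · refine IsClosed.inter (isClosed_eq (by fun_prop) continuous_const)
        (isClosed_eq ?_ continuous_const)
      simp only [dotProduct]
      fun_prop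
    · refine (Metric.isBounded_closedBall (x := (0 : Fin N → ℝ)) (r := 1)).subset ?_
      rintro x ⟨-, hx⟩
      rw [mem_closedBall_zero_iff, pi_norm_le_iff_of_nonneg zero_le_one]
      intro i
      have : x i * x i ≤ 1 := by
        rw [← hx]
        exact Finset.single_le_sum (f := fun i => x i * x i) (fun i _ => mul_self_nonneg _)
          (Finset.mem_univ i)
      rw [Real.norm_eq_abs]
      exact abs_le_one_iff_mul_self_le_one.2 this
  rcases K.eq_empty_or_nonempty with hE | hE
  · refine ⟨1, one_pos, fun x hx => ?_⟩
    by_cases h0 : x ⬝ᵥ x = 0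
    · rw [h0, mul_zero]
      exact dotProduct_laplacian_mulVec_nonneg hw x
    · exfalso
      have hp : 0 < x ⬝ᵥ x := lt_of_le_of_ne
        (Finset.sum_nonneg fun i _ => mul_self_nonneg (x i)) (Ne.symm h0)
      have : (√(x ⬝ᵥ x))⁻¹ • x ∈ K := by
        refine ⟨by simp [← Finset.mul_sum, hx], ?_⟩
        rw [smul_dotProduct, dotProduct_smul, smul_eq_mul, smul_eq_mul, ← mul_assoc, ← mul_inv,
          Real.mul_self_sqrt hp.le, inv_mul_cancel₀ h0]
      rw [hE] at this
      exact this
  · obtain ⟨x₀, hx₀, hmin⟩ := hK.exists_isMinOn hE hq.continuousOn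
    have hpos : 0 < q x₀ := by
      refine lt_of_le_of_ne (dotProduct_laplacian_mulVec_nonneg hw x₀) fun h => ?_
      have hc := eq_of_dotProduct_laplacian_mulVec_eq_zero hw h.symm
      have hz : x₀ = 0 := by
        ext i
        have h1 : ∑ j, x₀ j = N * x₀ i := by
          rw [Finset.sum_congr rfl fun j _ => hc j i]
          simp
        have hN : (N : ℝ) ≠ 0 := by
          have := i.pos
          positivity
        rw [hx₀.1] at h1
        exact (mul_eq_zero.1 h1.symm).resolve_left hN
      have := hx₀.2
      simp [hz] at this
    refine ⟨q x₀, hpos, fun x hx => ?_⟩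
    by_cases h0 : x ⬝ᵥ x = 0
    · rw [h0, mul_zero]
      exact dotProduct_laplacian_mulVec_nonneg hw x
    · have hp : 0 < x ⬝ᵥ x := lt_of_le_of_ne
        (Finset.sum_nonneg fun i _ => mul_self_nonneg (x i)) (Ne.symm h0)
      have hm : (√(x ⬝ᵥ x))⁻¹ • x ∈ K := by
        refine ⟨by simp [← Finset.mul_sum, hx], ?_⟩
        rw [smul_dotProduct, dotProduct_smul, smul_eq_mul, smul_eq_mul, ← mul_assoc, ← mul_inv,
          Real.mul_self_sqrt hp.le, inv_mul_cancel₀ h0]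
      have h1 : q x₀ ≤ q ((√(x ⬝ᵥ x))⁻¹ • x) := hmin hm
      have h2 : q ((√(x ⬝ᵥ x))⁻¹ • x) = (x ⬝ᵥ x)⁻¹ * (x ⬝ᵥ laplacian w *ᵥ x) := by
        simp only [q]
        rw [mulVec_smul, smul_dotProduct, dotProduct_smul, smul_eq_mul, smul_eq_mul, ← mul_assoc,
          ← mul_inv, Real.mul_self_sqrt hp.le]
      rw [h2, inv_mul_eq_div, le_div_iff₀ hp] at h1
      exact h1

/-- Two kernel eigenvectors would both be constant and nonzero, hence not orthogonal. -/
lemma exists_eigenvalues_eq_zero_unique (hw : IsConnectedUndirected w) (hN : 0 < N) :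
    ∃ k₀, (laplacian_isHermitian hw).eigenvalues k₀ = 0 ∧
      ∀ k, k ≠ k₀ → 0 < (laplacian_isHermitian hw).eigenvalues k := by
  set hL := laplacian_isHermitian hw
  have hdet : (laplacian w).det = 0 := by
    refine exists_mulVec_eq_zero_iff.1 ⟨fun _ => 1, fun h => ?_, laplacian_mulVec_const w 1⟩
    exact one_ne_zero (congrFun h ⟨0, hN⟩)
  rw [hL.det_eq_prod_eigenvalues] at hdet
  obtain ⟨k₀, -, hk₀⟩ := Finset.prod_eq_zero_iff.1 hdet
  have hk₀' : hL.eigenvalues k₀ = 0 := by simpa using hk₀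
  refine ⟨k₀, hk₀', fun k hk => ?_⟩
  have hform : ∀ k, (hL.eigenvectorBasis k).ofLp ⬝ᵥ
      laplacian w *ᵥ (hL.eigenvectorBasis k).ofLp = hL.eigenvalues k := by
    intro k
    rw [hL.eigenvalues_eq]
    simp
  refine lt_of_le_of_ne (hform k ▸ dotProduct_laplacian_mulVec_nonneg hw _) fun h => ?_
  have hc := eq_of_dotProduct_laplacian_mulVec_eq_zero hw ((hform k).trans h.symm)
  have hc₀ := eq_of_dotProduct_laplacian_mulVec_eq_zero hw ((hform k₀).trans hk₀')
  have horth := hL.eigenvectorBasis.orthonormal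
  have hne : ∀ k, (∀ i j, hL.eigenvectorBasis k i = hL.eigenvectorBasis k j) →
      hL.eigenvectorBasis k ⟨0, hN⟩ ≠ 0 := by
    intro k hk h0
    refine horth.ne_zero k ?_
    ext i
    simpa [h0] using hk i ⟨0, hN⟩
  have h0 : inner ℝ (hL.eigenvectorBasis k) (hL.eigenvectorBasis k₀) = 0 := horth.2 hk
  have h1 : inner ℝ (hL.eigenvectorBasis k) (hL.eigenvectorBasis k₀) =
      N * (hL.eigenvectorBasis k₀ ⟨0, hN⟩ * hL.eigenvectorBasis k ⟨0, hN⟩) := by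
    rw [PiLp.inner_apply, Finset.sum_congr rfl fun i _ => by rw [hc i ⟨0, hN⟩, hc₀ i ⟨0, hN⟩]]
    simp
  rw [h1] at h0
  have hN' : (N : ℝ) ≠ 0 := by positivity
  exact mul_ne_zero hN' (mul_ne_zero (hne k₀ hc₀) (hne k hc)) h0

end Laplacian

/-! ### Spectrum of `Γ` and upper bounds for `λ₃`. -/

section Spectrum

open Polynomial

variable {N : ℕ}

lemma charpoly_Gam (γ : ℝ) (L : Matrix (Fin N) (Fin N) ℝ) :
    (Gam γ L).charpoly = ((X ^ 2 : ℝ[X]) • (1 : Matrix (Fin N) (Fin N) ℝ[X]) +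
      (C γ * X + 1 : ℝ[X]) • L.map C).det := by
  set Q := (X ^ 2 : ℝ[X]) • (1 : Matrix (Fin N) (Fin N) ℝ[X]) + (C γ * X + 1 : ℝ[X]) • L.map C
  set D := (X : ℝ[X]) • (1 : Matrix (Fin N) (Fin N) ℝ[X]) + (C γ : ℝ[X]) • L.map C
  have hM : (Gam γ L).charmatrix =
      fromBlocks ((X : ℝ[X]) • (1 : Matrix (Fin N) (Fin N) ℝ[X])) (-1) (L.map C) D := by
    have hmap : ∀ A : Matrix (Fin N) (Fin N) ℝ, (-A).map (C : ℝ → ℝ[X]) = -A.map C := by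
      intro A; ext i j; simp
    have hX : ∀ A : Matrix (Fin N) (Fin N) ℝ, A.charmatrix = (X : ℝ[X]) • 1 - A.map C := by
      intro A
      rw [charmatrix, smul_one_eq_diagonal]
      rfl
    rw [Gam, charmatrix_fromBlocks, hX, hX]
    congr 1
    · ext i j; simp
    · ext i j k; rcases eq_or_ne i j with rfl | h <;> simp [one_apply, *]
    · rw [hmap, neg_neg]
    · rw [hmap, sub_neg_eq_add]
      congr 1
      ext i j; simp
  -- The right factor is `[0, 1; -1, X]`, written as a product of unitriangular blocks so that its
  -- determinant is visibly 1. It clears the upper right block without inverting `X`.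
  have hK : (Gam γ L).charmatrix * ((fromBlocks 1 1 0 1 * fromBlocks 1 0 (-1) 1) *
      fromBlocks 1 (1 - (X : ℝ[X]) • (1 : Matrix (Fin N) (Fin N) ℝ[X])) 0 1) =
      fromBlocks 1 0 (-D) Q := by
    rw [hM]
    simp only [fromBlocks_multiply]
    congr 1
    · simp
    · simp
    · simp
    · simp only [Q, D, mul_one, mul_zero, zero_add, mul_neg, mul_sub, mul_add, mul_smul_comm]
      module
  have := congrArg Matrix.det hK
  rw [det_mul, det_mul, det_mul, det_fromBlocks_zero₂₁, det_fromBlocks_zero₁₂,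
    det_fromBlocks_zero₂₁, det_fromBlocks_zero₁₂] at this
  simpa [charpoly] using this

lemma charpoly_Gam_eq_prod (γ : ℝ) {L : Matrix (Fin N) (Fin N) ℝ} (hL : L.IsHermitian) :
    (Gam γ L).charpoly =
      ∏ k, (X ^ 2 + C (γ * hL.eigenvalues k) * X + C (hL.eigenvalues k)) := by
  set U : Matrix (Fin N) (Fin N) ℝ := hL.eigenvectorUnitary.1
  have hU : U * star U = 1 := Unitary.coe_mul_star_self hL.eigenvectorUnitary
  have hspec : L = U * diagonal hL.eigenvalues * star U := hL.spectral_theorem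
  have hU' : U.map C * (star U).map C = (1 : Matrix (Fin N) (Fin N) ℝ[X]) := by
    rw [← Matrix.map_mul, hU, Matrix.map_one _ C_0 C_1]
  have hQ : (X ^ 2 : ℝ[X]) • (1 : Matrix (Fin N) (Fin N) ℝ[X]) + (C γ * X + 1 : ℝ[X]) • L.map C =
      U.map C * diagonal (fun k => X ^ 2 + C (γ * hL.eigenvalues k) * X + C (hL.eigenvalues k)) *
        (star U).map C := by
    have hd : diagonal (fun k => X ^ 2 + C (γ * hL.eigenvalues k) * X + C (hL.eigenvalues k)) =
        (X ^ 2 : ℝ[X]) • (1 : Matrix (Fin N) (Fin N) ℝ[X]) +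
          (C γ * X + 1 : ℝ[X]) • (diagonal hL.eigenvalues).map C := by
      rw [smul_one_eq_diagonal, diagonal_map C_0, ← diagonal_smul, diagonal_add]
      congr 1
      ext1 k
      simp only [Pi.smul_apply, smul_eq_mul, C_mul]
      ring
    have hLm : L.map C = U.map C * (diagonal hL.eigenvalues).map C * (star U).map C := by
      rw [← Matrix.map_mul, ← Matrix.map_mul, ← hspec]
    rw [hd, mul_add, add_mul, mul_smul_comm, mul_smul_comm, smul_mul_assoc, smul_mul_assoc,
      mul_one, hU', hLm]
  rw [charpoly_Gam, hQ, det_mul, det_mul, mul_right_comm, ← det_mul, hU', det_one, one_mul,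
    det_diagonal]

/-- The complex roots of `X² + b X + c`, described by Vieta's formulas. -/
lemma exists_roots_quadratic (b c : ℂ) :
    ∃ z₁ z₂ : ℂ, z₁ + z₂ = -b ∧ z₁ * z₂ = c ∧
      (X ^ 2 + C b * X + C c : ℂ[X]) = (X - C z₁) * (X - C z₂) := by
  obtain ⟨s, hs⟩ := IsAlgClosed.exists_pow_nat_eq (b ^ 2 - 4 * c) (n := 2) two_pos
  have h1 : (-b + s) / 2 + (-b - s) / 2 = -b := by ring
  have h2 : (-b + s) / 2 * ((-b - s) / 2) = c := by linear_combination -hs / 4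
  refine ⟨(-b + s) / 2, (-b - s) / 2, h1, h2, ?_⟩
  have e1 : C ((-b + s) / 2) + C ((-b - s) / 2) = -(C b : ℂ[X]) := by rw [← C_add, h1, C_neg]
  have e2 : C ((-b + s) / 2) * C ((-b - s) / 2) = (C c : ℂ[X]) := by rw [← C_mul, h2]
  linear_combination X * e1 - e2

/-- Either the roots are real with positive product and negative sum, or their real parts coincide
and equal `-b / 2`. -/
lemma re_neg_of_vieta {b c : ℝ} (hb : 0 < b) (hc : 0 < c) {z₁ z₂ : ℂ} (h1 : z₁ + z₂ = -(b : ℂ))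
    (h2 : z₁ * z₂ = c) : z₁.re < 0 ∧ z₂.re < 0 := by
  have hre : z₁.re + z₂.re = -b := by simpa using congrArg Complex.re h1
  have him : z₁.im + z₂.im = 0 := by simpa using congrArg Complex.im h1
  have hmr : z₁.re * z₂.re - z₁.im * z₂.im = c := by simpa using congrArg Complex.re h2
  have hmi : z₁.re * z₂.im + z₁.im * z₂.re = 0 := by simpa using congrArg Complex.im h2
  have e : z₂.im = -z₁.im := by linarith
  rw [e] at hmr hmi
  have hf : z₁.im * (z₂.re - z₁.re) = 0 := by linear_combination hmi
  rcases mul_eq_zero.1 hf with h | h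
  · rw [h] at hmr
    have : 0 < z₁.re * z₂.re := by linarith
    rcases mul_pos_iff.1 this with ⟨_, _⟩ | h
    · linarith
    · exact h
  · constructor <;> linarith

/-- One of the two roots of `X² + γ μ X + μ` lies to the right of `-γ μ / 2`. -/
lemma exists_re_ge_of_vieta {γ μ : ℝ} (hγ : 0 < γ) (hμ : 0 < μ) {z₁ z₂ : ℂ}
    (h1 : z₁ + z₂ = -((γ * μ : ℝ) : ℂ)) (h2 : z₁ * z₂ = (μ : ℝ)) :
    (-(γ * μ / 2) ≤ z₁.re ∨ -(γ * μ / 2) ≤ z₂.re) ∧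
      (-(2 / γ) ≤ z₁.re ∨ -(2 / γ) ≤ z₂.re) := by
  obtain ⟨hn1, hn2⟩ := re_neg_of_vieta (by positivity) hμ h1 h2
  have hre : z₁.re + z₂.re = -(γ * μ) := by
    have := congrArg Complex.re h1
    simpa using this
  refine ⟨?_, ?_⟩
  · by_contra! h
    linarith [h.1, h.2]
  · by_contra! h
    have hmr : z₁.re * z₂.re - z₁.im * z₂.im = μ := by simpa using congrArg Complex.re h2
    have him : z₁.im + z₂.im = 0 := by simpa using congrArg Complex.im h1
    have e : z₂.im = -z₁.im := by linarith
    rw [e] at hmr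
    have g1 : 2 < γ * -z₁.re := by
      have := h.1
      rw [lt_neg, div_lt_iff₀ hγ] at this
      linarith
    have g2 : 2 < γ * -z₂.re := by
      have := h.2
      rw [lt_neg, div_lt_iff₀ hγ] at this
      linarith
    have hmi : z₁.re * z₂.im + z₁.im * z₂.re = 0 := by simpa using congrArg Complex.im h2
    -- With `a`, `b` the negated real parts, `a b ≤ μ` and `a + b = γ μ`. But `γ a > 2` and `γ b >
    -- 2` give `γ a b > a + b`, that is `a b > μ`.
    have hmp : z₁.re * z₂.re ≤ μ := by nlinarith [sq_nonneg z₁.im]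
    nlinarith [mul_pos (neg_pos.2 hn1) (neg_pos.2 hn2), mul_pos (sub_pos.2 g1) (neg_pos.2 hn2),
      mul_pos (sub_pos.2 g2) (neg_pos.2 hn1)]

/-- Two zeros followed by negative numbers: the third largest entry. -/
lemma getD_two_sort_cons_zero_zero {t : Multiset ℝ} (ht : ∀ a ∈ t, a < 0) (ht0 : t ≠ 0) :
    (((0 : ℝ) ::ₘ 0 ::ₘ t).sort (· ≥ ·)).getD 2 0 ∈ t ∧
      ∀ a ∈ t, a ≤ (((0 : ℝ) ::ₘ 0 ::ₘ t).sort (· ≥ ·)).getD 2 0 := by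
  have h0 : ∀ b ∈ t, (0 : ℝ) ≥ b := fun b hb => (ht b hb).le
  have h1 : ∀ b ∈ (0 : ℝ) ::ₘ t, (0 : ℝ) ≥ b := by
    intro b hb
    rcases Multiset.mem_cons.1 hb with rfl | hb
    · exact le_rfl
    · exact h0 b hb
  rw [Multiset.sort_cons _ _ _ h1, Multiset.sort_cons _ _ _ h0]
  have hs := Multiset.pairwise_sort t (· ≥ ·)
  have hm : ∀ a, a ∈ t.sort (· ≥ ·) ↔ a ∈ t := fun a => Multiset.mem_sort (· ≥ ·)
  cases hl : t.sort (· ≥ ·) with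
  | nil =>
    exfalso
    obtain ⟨a, ha⟩ := Multiset.exists_mem_of_ne_zero ht0
    have := (hm a).2 ha
    simp [hl] at this
  | cons q l =>
    rw [hl] at hs
    simp only [hl] at hm
    simp only [List.getD_cons_succ, List.getD_cons_zero]
    refine ⟨(hm q).1 List.mem_cons_self, fun a ha => ?_⟩
    rcases List.mem_cons.1 ((hm a).2 ha) with rfl | h
    · exact le_rfl
    · exact (List.pairwise_cons.1 hs).1 a h

lemma absReLambda3_Gam {w : Matrix (Fin N) (Fin N) ℝ} (hw : IsConnectedUndirected w)
    (hN : 2 ≤ N) :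
    ∃ μ : ℝ, 0 < μ ∧ ∀ γ : ℝ, 0 < γ → 0 < absReLambda3 (Gam γ (laplacian w)) ∧
      absReLambda3 (Gam γ (laplacian w)) ≤ γ * μ / 2 ∧
      absReLambda3 (Gam γ (laplacian w)) ≤ 2 / γ := by
  obtain ⟨k₀, hk₀, hpos⟩ := exists_eigenvalues_eq_zero_unique hw (by omega)
  set hL := laplacian_isHermitian hw
  have : Nontrivial (Fin N) := Fin.nontrivial_iff_two_le.2 hN
  obtain ⟨k₁, hk₁⟩ := exists_ne k₀
  refine ⟨hL.eigenvalues k₁, hpos k₁ hk₁, fun γ hγ => ?_⟩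
  choose z₁ z₂ hz using fun k => exists_roots_quadratic ((γ * hL.eigenvalues k : ℝ) : ℂ)
    (hL.eigenvalues k : ℝ)
  -- The kernel of `L` contributes the double root 0 and all other roots have negative real part, so
  -- the entry of index 2 is the largest real part occurring in `t`.
  set t : Multiset ℂ := ∑ k ∈ Finset.univ.erase k₀, ({z₁ k, z₂ k} : Multiset ℂ)
  have hroots : ((Gam γ (laplacian w)).map Complex.ofReal).charpoly.roots = 0 ::ₘ 0 ::ₘ t := by
    have h1 : ((Gam γ (laplacian w)).map Complex.ofReal).charpoly =
        ∏ k, ((X - C (z₁ k)) * (X - C (z₂ k))) := by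
      have := Matrix.charpoly_map (Gam γ (laplacian w)) Complex.ofRealHom
      rw [charpoly_Gam_eq_prod γ hL, Polynomial.map_prod] at this
      refine Eq.trans this (Finset.prod_congr rfl fun k _ => ?_)
      rw [← (hz k).2.2]
      simp
    have h2 : ((Gam γ (laplacian w)).map Complex.ofReal).charpoly =
        X * X * ∏ k ∈ Finset.univ.erase k₀, ((X - C (z₁ k)) * (X - C (z₂ k))) := by
      rw [h1, ← Finset.mul_prod_erase _ _ (Finset.mem_univ k₀), ← (hz k₀).2.2, hk₀]
      simp [pow_two]
    have hne : ∏ k ∈ Finset.univ.erase k₀, ((X - C (z₁ k)) * (X - C (z₂ k))) ≠ 0 :=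
      Finset.prod_ne_zero_iff.2 fun k _ => mul_ne_zero (X_sub_C_ne_zero _) (X_sub_C_ne_zero _)
    rw [h2, roots_mul (mul_ne_zero (mul_ne_zero X_ne_zero X_ne_zero) hne),
      roots_mul (mul_ne_zero X_ne_zero X_ne_zero), roots_X, roots_prod _ _ hne]
    simp only [t, Multiset.bind, Multiset.join]
    change _ = ({0} + ({0} + _) : Multiset ℂ)
    rw [add_assoc]
    congr 2
    refine congrArg Multiset.sum (Multiset.map_congr rfl fun k _ => ?_)
    rw [roots_mul (mul_ne_zero (X_sub_C_ne_zero _) (X_sub_C_ne_zero _)), roots_X_sub_C,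
      roots_X_sub_C]
    rfl
  have hmem : ∀ z, z ∈ t ↔ ∃ k, k ≠ k₀ ∧ (z = z₁ k ∨ z = z₂ k) := by
    intro z
    simp [t, Multiset.mem_sum]
  have hneg : ∀ a ∈ t.map Complex.re, a < 0 := by
    intro a ha
    obtain ⟨z, hzt, rfl⟩ := Multiset.mem_map.1 ha
    obtain ⟨k, hk, h⟩ := (hmem z).1 hzt
    have := re_neg_of_vieta (mul_pos hγ (hpos k hk)) (hpos k hk) (hz k).1 (hz k).2.1
    rcases h with rfl | rfl
    · exact this.1
    · exact this.2
  have hm1 : (z₁ k₁).re ∈ t.map Complex.re :=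
    Multiset.mem_map_of_mem _ ((hmem _).2 ⟨k₁, hk₁, Or.inl rfl⟩)
  have hm2 : (z₂ k₁).re ∈ t.map Complex.re :=
    Multiset.mem_map_of_mem _ ((hmem _).2 ⟨k₁, hk₁, Or.inr rfl⟩)
  obtain ⟨hq, hmax⟩ := getD_two_sort_cons_zero_zero hneg (fun h => by simp [h] at hm1)
  rw [absReLambda3, hroots, Multiset.map_cons, Multiset.map_cons, Complex.zero_re]
  generalize (((0 : ℝ) ::ₘ 0 ::ₘ t.map Complex.re).sort (· ≥ ·)).getD 2 0 = q at hq hmax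
  rw [abs_of_neg (hneg q hq)]
  have g1 := hmax _ hm1
  have g2 := hmax _ hm2
  obtain ⟨h1, h2⟩ := exists_re_ge_of_vieta hγ (hpos k₁ hk₁) (hz k₁).1 (hz k₁).2.1
  refine ⟨neg_pos.2 (hneg q hq), ?_, ?_⟩
  · rcases h1 with h | h <;> linarith
  · rcases h2 with h | h <;> linarith

end Spectrum

lemma threshold_pos {c₀ c₁ : ℝ} (h₀ : 0 ≤ c₀) (h₁ : 0 ≤ c₁) (h : 0 < c₀ + c₁) (a : ℝ) :
    0 < c₀ + c₁ * Real.exp a := by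
  rcases h₀.eq_or_lt with rfl | h₀
  · have : 0 < c₁ := by linarith
    positivity
  · positivity

namespace Execution

/-! ### Event times and the closed loop as a perturbed linear system. -/

section Trajectory

variable {N : ℕ} {x : Execution N} {w : Matrix (Fin N) (Fin N) ℝ} {γ c₀ c₁ α : ℝ}

lemma IsTrajectory.event_monotone (hx : x.IsTrajectory w γ c₀ c₁ α) (i : Fin N) :
    Monotone (x.event i) := by
  refine monotone_nat_of_le_succ fun ℓ => ?_
  rw [hx.event_succ i ℓ]
  refine le_sInf ?_
  rintro _ ⟨s, ⟨hs, -⟩, rfl⟩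
  exact hs

lemma IsTrajectory.event_nonneg (hx : x.IsTrajectory w γ c₀ c₁ α) (i : Fin N) (ℓ : ℕ) :
    0 ≤ x.event i ℓ :=
  (hx.event_zero i).ge.trans (hx.event_monotone i (Nat.zero_le ℓ))

lemma IsTrajectory.coe_eventTime (hx : x.IsTrajectory w γ c₀ c₁ α) {i : Fin N} {ℓ : ℕ}
    (h : x.event i ℓ ≠ ⊤) : (x.eventTime i ℓ : EReal) = x.event i ℓ :=
  EReal.coe_toReal h fun hb => by
    have := hx.event_nonneg i ℓ
    rw [hb] at this
    exact absurd this (by simp)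

lemma IsTrajectory.eventTime_nonneg (hx : x.IsTrajectory w γ c₀ c₁ α) (i : Fin N) (ℓ : ℕ) :
    0 ≤ x.eventTime i ℓ :=
  EReal.toReal_nonneg (hx.event_nonneg i ℓ)

lemma IsTrajectory.Icc_subset {a b : ℝ} (ha : 0 ≤ a) (hb : (b : EReal) < x.horizon) :
    Set.Icc a b ⊆ {s : ℝ | 0 ≤ s ∧ (s : EReal) < x.horizon} := fun _ hs =>
  ⟨ha.trans hs.1, (EReal.coe_le_coe_iff.2 hs.2).trans_lt hb⟩

lemma trigger_eq (γ c₀ c₁ α : ℝ) (i : Fin N) (ℓ : ℕ) (s : ℝ) :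
    x.trigger γ c₀ c₁ α i ℓ s = √(x.errR i ℓ s ^ 2 + (γ * x.errV i ℓ s) ^ 2) -
      (c₀ + c₁ * Real.exp (-α * s)) := by
  simp only [trigger, EuclideanSpace.norm_eq, Fin.sum_univ_two, Real.norm_eq_abs, sq_abs,
    Matrix.cons_val_zero, Matrix.cons_val_one]

lemma IsTrajectory.continuousOn_trigger (hx : x.IsTrajectory w γ c₀ c₁ α) (i : Fin N) (ℓ : ℕ) :
    ContinuousOn (x.trigger γ c₀ c₁ α i ℓ) {s : ℝ | 0 ≤ s ∧ (s : EReal) < x.horizon} := by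
  have hr := hx.cont_r i
  have hv := hx.cont_v i
  rw [funext (trigger_eq γ c₀ c₁ α i ℓ)]
  simp only [errR, errV, holdR]
  fun_prop

/-- A finite infimum in `event_succ` is attained. The trigger is continuous only before the horizon,
so the zero set is first cut off at one of its own points to become compact. -/
lemma IsTrajectory.exists_event_succ (hx : x.IsTrajectory w γ c₀ c₁ α) {i : Fin N} {ℓ : ℕ}
    (h : x.event i (ℓ + 1) ≠ ⊤) :
    ∃ t : ℝ, x.event i (ℓ + 1) = t ∧ (t : EReal) < x.horizon ∧
      x.trigger γ c₀ c₁ α i ℓ t = 0 := by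
  set S := {s : ℝ | x.event i ℓ ≤ (s : EReal) ∧ (s : EReal) < x.horizon ∧
        x.trigger γ c₀ c₁ α i ℓ s = 0} with hS
  have hsucc := hx.event_succ i ℓ
  rw [← hS] at hsucc
  have hne : S.Nonempty := by
    rw [Set.nonempty_iff_ne_empty]
    intro he
    rw [he, Set.image_empty, sInf_empty] at hsucc
    exact h hsucc
  obtain ⟨s₀, hs₀⟩ := hne
  have htop : x.event i ℓ ≠ ⊤ := (hs₀.1.trans_lt (EReal.coe_lt_top _)).ne
  have hcoe := hx.coe_eventTime htop
  set a := x.eventTime i ℓ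
  have ha0 : 0 ≤ a := hx.eventTime_nonneg i ℓ
  have hK : IsCompact (Set.Icc a s₀ ∩ x.trigger γ c₀ c₁ α i ℓ ⁻¹' {0}) := by
    refine isCompact_Icc.of_isClosed_subset ?_ Set.inter_subset_left
    exact ((hx.continuousOn_trigger i ℓ).mono
      (IsTrajectory.Icc_subset ha0 hs₀.2.1)).preimage_isClosed_of_isClosed isClosed_Icc
        isClosed_singleton
  have has₀ : a ≤ s₀ := by
    rw [← EReal.coe_le_coe_iff, hcoe]
    exact hs₀.1
  obtain ⟨t, ht, htmin⟩ := hK.exists_isLeast ⟨s₀, ⟨has₀, le_rfl⟩, hs₀.2.2⟩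
  have htS : t ∈ S := ⟨by rw [← hcoe]; exact EReal.coe_le_coe_iff.2 ht.1.1,
    (EReal.coe_le_coe_iff.2 ht.1.2).trans_lt hs₀.2.1, ht.2⟩
  refine ⟨t, ?_, htS.2.1, htS.2.2⟩
  rw [hsucc]
  suffices h : IsLeast ((fun s : ℝ => (s : EReal)) '' S) (t : EReal) from h.isGLB.sInf_eq
  refine ⟨⟨t, htS, rfl⟩, ?_⟩
  rintro _ ⟨s, hs, rfl⟩
  rw [EReal.coe_le_coe_iff]
  rcases le_total s s₀ with h' | h'
  · refine htmin ⟨⟨?_, h'⟩, hs.2.2⟩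
    rw [← EReal.coe_le_coe_iff, hcoe]
    exact hs.1
  · exact ht.1.2.trans h'

lemma IsTrajectory.exists_current_event (hx : x.IsTrajectory w γ c₀ c₁ α) (i : Fin N) {s : ℝ}
    (hs : 0 ≤ s) (hs' : (s : EReal) < x.horizon) :
    ∃ k, x.event i k ≤ (s : EReal) ∧ (s : EReal) < x.event i (k + 1) := by
  have h1 : (s : EReal) < ⨆ ℓ, x.event i ℓ := hs'.trans_le (iInf_le _ i)
  classical
  have h2 : ∃ ℓ, (s : EReal) < x.event i ℓ := lt_iSup_iff.1 h1
  have h0 : Nat.find h2 ≠ 0 := fun h0 => by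
    have := Nat.find_spec h2
    rw [h0, hx.event_zero] at this
    exact absurd this (not_lt.2 (EReal.coe_nonneg.2 hs))
  obtain ⟨k, hk⟩ := Nat.exists_eq_succ_of_ne_zero h0
  refine ⟨k, not_lt.1 (Nat.find_min h2 (by omega)), ?_⟩
  have := Nat.find_spec h2
  rwa [hk] at this

lemma trigger_eventTime (γ c₀ c₁ α : ℝ) (i : Fin N) (ℓ : ℕ) :
    x.trigger γ c₀ c₁ α i ℓ (x.eventTime i ℓ) =
      -(c₀ + c₁ * Real.exp (-α * x.eventTime i ℓ)) := by
  simp [trigger_eq, errR, errV, holdR, holdV]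

/-- At its own event time the trigger equals minus the threshold; by the intermediate value theorem,
reaching a nonnegative value would force an earlier next event. -/
lemma IsTrajectory.trigger_neg (hx : x.IsTrajectory w γ c₀ c₁ α) (h₀ : 0 ≤ c₀) (h₁ : 0 ≤ c₁)
    (h₂ : 0 < c₀ + c₁) {i : Fin N} {k : ℕ} {s : ℝ} (hk : x.event i k ≤ (s : EReal))
    (hk' : (s : EReal) < x.event i (k + 1)) (hs : (s : EReal) < x.horizon) :
    x.trigger γ c₀ c₁ α i k s < 0 := by
  by_contra! h
  have hcoe := hx.coe_eventTime (hk.trans_lt (EReal.coe_lt_top _)).ne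
  have ha0 : 0 ≤ x.eventTime i k := hx.eventTime_nonneg i k
  have has : x.eventTime i k ≤ s := by rwa [← EReal.coe_le_coe_iff, hcoe]
  have hneg : x.trigger γ c₀ c₁ α i k (x.eventTime i k) ≤ 0 := by
    rw [trigger_eventTime]
    linarith [threshold_pos h₀ h₁ h₂ (-α * x.eventTime i k)]
  obtain ⟨t, ht, ht0⟩ := intermediate_value_Icc has
    ((hx.continuousOn_trigger i k).mono (IsTrajectory.Icc_subset ha0 hs)) ⟨hneg, h⟩
  have : x.event i (k + 1) ≤ (t : EReal) := by
    rw [hx.event_succ i k]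
    exact sInf_le ⟨t, ⟨by rw [← hcoe]; exact EReal.coe_le_coe_iff.2 ht.1,
      (EReal.coe_le_coe_iff.2 ht.2).trans_lt hs, ht0⟩, rfl⟩
  exact absurd (this.trans (EReal.coe_le_coe_iff.2 ht.2)) (not_le.2 hk')

lemma control_eq (w : Matrix (Fin N) (Fin N) ℝ) (γ : ℝ) (k : Fin N → ℕ) (i : Fin N) (s : ℝ) :
    x.control w γ k i s = -(laplacian w *ᵥ fun j => x.r j s + γ * x.v j s +
      (x.errR j (k j) s + γ * x.errV j (k j) s)) i := by
  rw [control, laplacian_mulVec]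
  congr 1
  refine Finset.sum_congr rfl fun j _ => ?_
  simp only [errR, errV]
  ring

/-- The closed loop as a linear system with an input `f`, bounded by the threshold, that collects
the measurement errors. -/
lemma IsTrajectory.exists_error_input (hx : x.IsTrajectory w γ c₀ c₁ α) (h₀ : 0 ≤ c₀)
    (h₁ : 0 ≤ c₁) (h₂ : 0 < c₀ + c₁) :
    ∃ f : ℝ → Fin N → ℝ, ∀ s : ℝ, 0 ≤ s → (s : EReal) < x.horizon →
      (∀ i, HasDerivWithinAt (x.v i)
        (-(laplacian w *ᵥ fun j => x.r j s + γ * x.v j s + f s j) i) (Set.Ici s) s) ∧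
      ∀ j, f s j ^ 2 ≤ 2 * (c₀ + c₁ * Real.exp (-α * s)) ^ 2 := by
  have key : ∀ s : ℝ, ∃ f : Fin N → ℝ, 0 ≤ s → (s : EReal) < x.horizon →
      (∀ i, HasDerivWithinAt (x.v i)
        (-(laplacian w *ᵥ fun j => x.r j s + γ * x.v j s + f j) i) (Set.Ici s) s) ∧
      ∀ j, f j ^ 2 ≤ 2 * (c₀ + c₁ * Real.exp (-α * s)) ^ 2 := by
    intro s
    by_cases hs : 0 ≤ s ∧ (s : EReal) < x.horizon
    · choose k hk using fun i => hx.exists_current_event i hs.1 hs.2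
      refine ⟨fun j => x.errR j (k j) s + γ * x.errV j (k j) s, fun _ _ => ⟨fun i => ?_, fun j => ?_⟩⟩
      · rw [← control_eq]
        exact hx.deriv_v i s hs.1 hs.2 k hk
      · have hn := (hx.trigger_neg h₀ h₁ h₂ (hk j).1 (hk j).2 hs.2).le
        rw [trigger_eq, sub_nonpos, Real.sqrt_le_left (threshold_pos h₀ h₁ h₂ _).le] at hn
        -- The factor 2, and later the `√(2N)`, comes from `(a + b)² ≤ 2 (a² + b²)`.
        nlinarith [sq_nonneg (x.errR j (k j) s - γ * x.errV j (k j) s)]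
    · exact ⟨0, fun h h' => absurd ⟨h, h'⟩ hs⟩
  choose f hf using key
  exact ⟨f, hf⟩

end Trajectory

end Execution

namespace Execution

/-! ### Absence of Zeno behaviour. -/

section Zeno

variable {N : ℕ} {x : Execution N} {w : Matrix (Fin N) (Fin N) ℝ} {γ c₀ c₁ α : ℝ}

lemma exists_norm_mulVec_le (L : Matrix (Fin N) (Fin N) ℝ) :
    ∃ K : ℝ, 0 ≤ K ∧ ∀ y : Fin N → ℝ, ‖L *ᵥ y‖ ≤ K * ‖y‖ :=
  ⟨‖LinearMap.toContinuousLinearMap L.mulVecLin‖, norm_nonneg _,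
    fun y => (LinearMap.toContinuousLinearMap L.mulVecLin).le_opNorm y⟩

/-- Grönwall for the state in the sup norm. The bounds depend on `T` but not on the number of events
before `T`. -/
lemma IsTrajectory.exists_state_bound (hx : x.IsTrajectory w γ c₀ c₁ α) (hγ : 0 < γ)
    (h₀ : 0 ≤ c₀) (h₁ : 0 ≤ c₁) (h₂ : 0 < c₀ + c₁) (T : ℝ) :
    ∃ B U : ℝ, 0 ≤ B ∧ 0 ≤ U ∧ ∀ i, ∀ s : ℝ, 0 ≤ s → s ≤ T → (s : EReal) < x.horizon →
      |x.v i s| ≤ B ∧ ∃ u, |u| ≤ U ∧ HasDerivWithinAt (x.v i) u (Set.Ici s) s := by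
  obtain ⟨f, hf⟩ := hx.exists_error_input h₀ h₁ h₂
  obtain ⟨K₀, hK₀, hL⟩ := exists_norm_mulVec_le (laplacian w)
  set M := c₀ + c₁ * Real.exp (|α| * |T|)
  have hM : 0 ≤ M := (threshold_pos h₀ h₁ h₂ _).le
  have hfM : ∀ s : ℝ, 0 ≤ s → s ≤ T → (s : EReal) < x.horizon → ‖f s‖ ≤ 2 * M := by
    intro s hs hsT hs'
    rw [pi_norm_le_iff_of_nonneg (by positivity)]
    intro j
    have h := (hf s hs hs').2 j
    have he : c₀ + c₁ * Real.exp (-α * s) ≤ M := by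
      have : -α * s ≤ |α| * |T| := by
        refine (le_abs_self _).trans ?_
        rw [abs_mul, abs_neg]
        exact mul_le_mul_of_nonneg_left (abs_le_abs_of_nonneg hs hsT) (abs_nonneg _)
      have := Real.exp_le_exp.2 this
      simp only [M]
      gcongr
    rw [Real.norm_eq_abs]
    refine abs_le_of_sq_le_sq ?_ (by positivity)
    have := pow_le_pow_left₀ (threshold_pos h₀ h₁ h₂ (-α * s)).le he 2
    nlinarith
  set F : ℝ → (Fin N → ℝ) × (Fin N → ℝ) := fun s => (fun i => x.r i s, fun i => x.v i s)
  set u : ℝ → Fin N → ℝ := fun s i =>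
    -(laplacian w *ᵥ fun j => x.r j s + γ * x.v j s + f s j) i
  have hu : ∀ s : ℝ, 0 ≤ s → s ≤ T → (s : EReal) < x.horizon →
      ‖u s‖ ≤ K₀ * ((1 + γ) * ‖F s‖ + 2 * M) := by
    intro s hs hsT hs'
    have e : u s = -(laplacian w *ᵥ ((F s).1 + γ • (F s).2 + f s)) := rfl
    rw [e, norm_neg]
    refine (hL _).trans (mul_le_mul_of_nonneg_left ?_ hK₀)
    refine (norm_add_le _ _).trans (add_le_add ?_ (hfM s hs hsT hs'))
    refine (norm_add_le _ _).trans ?_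
    rw [norm_smul, Real.norm_eq_abs, abs_of_pos hγ, add_mul, one_mul]
    exact add_le_add (norm_fst_le _) (mul_le_mul_of_nonneg_left (norm_snd_le _) hγ.le)
  set K := 1 + K₀ * (1 + γ)
  have hF : ∀ s : ℝ, 0 ≤ s → s ≤ T → (s : EReal) < x.horizon →
      ‖F s‖ ≤ gronwallBound ‖F 0‖ K (K₀ * (2 * M)) |T| := by
    intro s hs hsT hs'
    have hsub := IsTrajectory.Icc_subset (x := x) le_rfl hs'
    have hcont : ContinuousOn F (Set.Icc 0 s) :=
      (continuousOn_pi.2 fun i => (hx.cont_r i).mono hsub).prodMk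
        (continuousOn_pi.2 fun i => (hx.cont_v i).mono hsub)
    have := norm_le_gronwallBound_of_norm_deriv_right_le (f' := fun s => ((F s).2, u s)) hcont
      (fun t ht => ?_) le_rfl (K := K) (ε := K₀ * (2 * M)) (fun t ht => ?_) s ⟨hs, le_rfl⟩
    · refine this.trans (gronwallBound_mono (norm_nonneg _) (by positivity) (by positivity) ?_)
      rw [sub_zero]
      exact hsT.trans (le_abs_self T)
    · have ht' := hsub ⟨ht.1, ht.2.le⟩
      exact (hasDerivWithinAt_pi.2 fun i => hx.deriv_r i t ht'.1 ht'.2).prodMk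
        (hasDerivWithinAt_pi.2 fun i => (hf t ht'.1 ht'.2).1 i)
    · have ht' := hsub ⟨ht.1, ht.2.le⟩
      have h1 := hu t ht'.1 (ht.2.le.trans hsT) ht'.2
      have h2 : ‖(F t).2‖ ≤ ‖F t‖ := norm_snd_le _
      rw [Prod.norm_mk]
      refine max_le ?_ ?_
      · have : 0 ≤ K₀ * (1 + γ) * ‖F t‖ := by positivity
        have : 0 ≤ K₀ * (2 * M) := by positivity
        simp only [K]
        linarith
      · have : 0 ≤ ‖F t‖ := norm_nonneg _
        simp only [K]
        linarith
  set B := gronwallBound ‖F 0‖ K (K₀ * (2 * M)) |T|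
  have hB : 0 ≤ B := by
    have := gronwallBound_mono (norm_nonneg (F 0)) (ε := K₀ * (2 * M)) (K := K) (by positivity)
      (by positivity) (abs_nonneg T)
    rw [gronwallBound_x0] at this
    exact (norm_nonneg _).trans this
  refine ⟨B, K₀ * ((1 + γ) * B + 2 * M), hB, by positivity, fun i s hs hsT hs' =>
    ⟨?_, u s i, ?_, (hf s hs hs').1 i⟩⟩
  · exact ((norm_le_pi_norm (F s).2 i).trans (norm_snd_le _)).trans (hF s hs hsT hs')
  · refine ((norm_le_pi_norm (u s) i).trans (hu s hs hsT hs')).trans ?_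
    have := hF s hs hsT hs'
    gcongr

theorem IsTrajectory.not_isZeno (hx : x.IsTrajectory w γ c₀ c₁ α) (hγ : 0 < γ)
    (h₀ : 0 ≤ c₀) (h₁ : 0 ≤ c₁) (h₂ : 0 < c₀ + c₁) : ¬ x.IsZeno := by
  rintro ⟨i, T, hT, hle⟩
  obtain ⟨B, U, hB, hU, hb⟩ := hx.exists_state_bound hγ h₀ h₁ h₂ T
  -- A lower bound for the threshold on `[0, T]`, whatever the sign of `α`.
  set m := c₀ + c₁ * Real.exp (-(|α| * T))
  have hm : 0 < m := threshold_pos h₀ h₁ h₂ _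
  have htop : ∀ ℓ, x.event i ℓ ≠ ⊤ := fun ℓ => ((hle ℓ).trans_lt (EReal.coe_lt_top T)).ne
  have hgap : ∀ ℓ, m ≤ (2 * B + γ * U) * (x.eventTime i (ℓ + 1) - x.eventTime i ℓ) := by
    intro ℓ
    obtain ⟨b, hb1, hbH, hb0⟩ := hx.exists_event_succ (htop (ℓ + 1))
    have hbe : x.eventTime i (ℓ + 1) = b := by rw [eventTime, hb1, EReal.toReal_coe]
    have hbT : b ≤ T := by
      have := hle (ℓ + 1)
      rwa [hb1, EReal.coe_le_coe_iff] at this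
    rw [hbe]
    set a := x.eventTime i ℓ with ha
    have ha0 : 0 ≤ a := hx.eventTime_nonneg i ℓ
    have hab : a ≤ b := by
      rw [← EReal.coe_le_coe_iff, ha, hx.coe_eventTime (htop ℓ), ← hb1]
      exact hx.event_monotone i (Nat.le_succ ℓ)
    have hsub := IsTrajectory.Icc_subset (x := x) ha0 hbH
    have hin : ∀ s ∈ Set.Ico a b, 0 ≤ s ∧ s ≤ T ∧ (s : EReal) < x.horizon := fun s hs =>
      ⟨ha0.trans hs.1, hs.2.le.trans hbT, (hsub ⟨hs.1, hs.2.le⟩).2⟩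
    have hr : |x.r i b - x.r i a| ≤ B * (b - a) :=
      norm_image_sub_le_of_norm_deriv_right_le_segment ((hx.cont_r i).mono hsub)
        (fun s hs => hx.deriv_r i s (hin s hs).1 (hin s hs).2.2)
        (fun s hs => (hb i s (hin s hs).1 (hin s hs).2.1 (hin s hs).2.2).1) b ⟨hab, le_rfl⟩
    have hv : |x.v i b - x.v i a| ≤ U * (b - a) := by
      have h : ∀ s, ∃ u, s ∈ Set.Ico a b → |u| ≤ U ∧ HasDerivWithinAt (x.v i) u (Set.Ici s) s := by
        intro s
        by_cases hs : s ∈ Set.Ico a b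
        · obtain ⟨-, u, hu⟩ := hb i s (hin s hs).1 (hin s hs).2.1 (hin s hs).2.2
          exact ⟨u, fun _ => hu⟩
        · exact ⟨0, fun h => absurd h hs⟩
      choose u hu using h
      exact norm_image_sub_le_of_norm_deriv_right_le_segment ((hx.cont_v i).mono hsub)
        (fun s hs => (hu s hs).2) (fun s hs => (hu s hs).1) b ⟨hab, le_rfl⟩
    have hva : |x.v i a| ≤ B := (hb i a ha0 (hab.trans hbT) (hsub ⟨le_rfl, hab⟩).2).1
    have hmb : m ≤ c₀ + c₁ * Real.exp (-α * b) := by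
      have : -(|α| * T) ≤ -α * b := by
        have h1 : α * b ≤ |α| * b := mul_le_mul_of_nonneg_right (le_abs_self α) (ha0.trans hab)
        have h2 : |α| * b ≤ |α| * T := mul_le_mul_of_nonneg_left hbT (abs_nonneg α)
        linarith
      have := Real.exp_le_exp.2 this
      simp only [m]
      gcongr
    rw [trigger_eq, sub_eq_zero] at hb0
    have hsq : √(x.errR i ℓ b ^ 2 + (γ * x.errV i ℓ b) ^ 2) ≤
        |x.errR i ℓ b| + γ * |x.errV i ℓ b| := by
      refine Real.sqrt_le_iff.2 ⟨by positivity, ?_⟩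
      have : 0 ≤ |x.errR i ℓ b| * (γ * |x.errV i ℓ b|) := by positivity
      rw [add_sq, mul_pow, mul_pow, sq_abs, sq_abs]
      linarith
    have heV : |x.errV i ℓ b| ≤ U * (b - a) := by
      rw [abs_sub_comm] at hv
      exact hv
    -- One `B` bounds the drift of the position, the other the slope of the first-order hold.
    have heR : |x.errR i ℓ b| ≤ 2 * B * (b - a) := by
      have e : x.errR i ℓ b = -(x.r i b - x.r i a) + (b - a) * x.v i a := by
        simp only [errR, holdR, ← ha]
        ring
      rw [e]
      refine (abs_add_le _ _).trans ?_
      rw [abs_neg, abs_mul, abs_of_nonneg (sub_nonneg.2 hab)]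
      have := mul_le_mul_of_nonneg_left hva (sub_nonneg.2 hab)
      linarith
    have := mul_le_mul_of_nonneg_left heV hγ.le
    linarith
  have hind : ∀ ℓ : ℕ, ℓ * m ≤ (2 * B + γ * U) * x.eventTime i ℓ := by
    intro ℓ
    induction ℓ with
    | zero => simpa using mul_nonneg (by positivity) (hx.eventTime_nonneg i 0)
    | succ ℓ ih =>
      have := hgap ℓ
      push_cast
      linarith
  obtain ⟨ℓ, hℓ⟩ := exists_nat_gt ((2 * B + γ * U) * T / m)
  rw [div_lt_iff₀ hm] at hℓ
  have hℓT : x.eventTime i ℓ ≤ T := by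
    rw [← EReal.coe_le_coe_iff, hx.coe_eventTime (htop ℓ)]
    exact hle ℓ
  have := mul_le_mul_of_nonneg_left hℓT (show 0 ≤ 2 * B + γ * U by positivity)
  linarith [hind ℓ]

lemma horizon_eq_top_of_not_isZeno (h : ¬ x.IsZeno) : x.horizon = ⊤ := by
  simp only [IsZeno, not_exists, not_and, not_forall, not_le] at h
  rw [horizon, iInf_eq_top]
  intro i
  rw [EReal.eq_top_iff_forall_lt]
  intro y
  obtain ⟨ℓ, hℓ⟩ := h i (max y 1) (by positivity)
  exact ((EReal.coe_le_coe_iff.2 (le_max_left y 1)).trans_lt hℓ).trans_le (le_iSup (x.event i) ℓ)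

end Zeno

end Execution

/-! ### Lyapunov estimate for the disagreement dynamics. -/

section Lyapunov

variable {N : ℕ} {w : Matrix (Fin N) (Fin N) ℝ}

/-- Ultimate bound from a scalar differential inequality for the right derivative. -/
lemma eventually_le_of_deriv_right_le {V V' g : ℝ → ℝ} {a G : ℝ} (ha : 0 < a)
    (hV : ContinuousOn V (Set.Ici 0))
    (hV' : ∀ s, 0 ≤ s → HasDerivWithinAt V (V' s) (Set.Ici s) s)
    (hle : ∀ s, 0 ≤ s → V' s ≤ -a * V s + g s) (hg : Tendsto g atTop (nhds G))
    {η : ℝ} (hη : 0 < η) : ∀ᶠ s in atTop, V s ≤ G / a + η := by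
  set R := G / a + η / 2 with hR
  have haR : a * R = G + a * η / 2 := by rw [hR]; field_simp
  have h1 : ∀ᶠ s in atTop, g s < a * R := by
    refine hg.eventually_lt_const ?_
    rw [haR]
    have : 0 < a * η := mul_pos ha hη
    linarith
  obtain ⟨S, hS⟩ := eventually_atTop.1 (h1.and (eventually_ge_atTop 0))
  have hS0 : 0 ≤ S := (hS S le_rfl).2
  have hexp : ∀ s, HasDerivAt (fun s => Real.exp (a * (s - S))) (Real.exp (a * (s - S)) * a) s := by
    intro s
    have : HasDerivAt (fun s => a * (s - S)) (a * 1) s :=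
      ((hasDerivAt_id s).sub_const S).const_mul a
    rw [mul_one] at this
    exact this.exp
  -- After `S` the inequality reads `V' ≤ -a (V - R)`, so `(V - R) exp (a (s - S))` is
  -- nonincreasing.
  have hdecay : ∀ s, S ≤ s → V s ≤ R + (V S - R) * Real.exp (-(a * (s - S))) := by
    intro s hs
    have h := image_le_of_deriv_right_le_deriv_boundary
      (f := fun s => (V s - R) * Real.exp (a * (s - S)))
      (f' := fun s => V' s * Real.exp (a * (s - S)) + (V s - R) * (Real.exp (a * (s - S)) * a))
      (a := S) (b := s) (B := fun _ => V S - R) (B' := fun _ => 0) ?_ ?_ ?_ continuousOn_const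
      (fun t _ => hasDerivWithinAt_const _ _ _) ?_ ⟨hs, le_rfl⟩
    · have h2 : V s - R = (V s - R) * Real.exp (a * (s - S)) * Real.exp (-(a * (s - S))) := by
        rw [mul_assoc, ← Real.exp_add, add_neg_cancel, Real.exp_zero, mul_one]
      have := mul_le_mul_of_nonneg_right h (Real.exp_pos (-(a * (s - S)))).le
      rw [← h2] at this
      linarith
    · refine ((hV.mono fun t ht => hS0.trans ht.1).sub continuousOn_const).mul ?_
      fun_prop
    · intro t ht
      exact ((hV' t (hS0.trans ht.1)).sub_const R).mul (hexp t).hasDerivWithinAt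
    · simp
    · intro t ht
      have h3 := hle t (hS0.trans ht.1)
      have h4 := (hS t ht.1).1
      have h5 : V' t + (V t - R) * a ≤ 0 := by linarith
      have := mul_nonpos_of_nonpos_of_nonneg h5 (Real.exp_pos (a * (t - S))).le
      linarith
  have hlim : Tendsto (fun s => R + (V S - R) * Real.exp (-(a * (s - S)))) atTop (nhds R) := by
    have h6 : Tendsto (fun s => a * (s - S)) atTop atTop :=
      (tendsto_atTop_add_const_right _ (-S) tendsto_id).const_mul_atTop ha
    have := ((Real.tendsto_exp_neg_atTop_nhds_zero.comp h6).const_mul (V S - R)).const_add R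
    simpa using this
  filter_upwards [hlim.eventually_lt_const (show R < G / a + η by linarith),
    eventually_ge_atTop S] with s hs hs'
  exact (hdecay s hs').trans hs.le

lemma norm_toLp_sq (y : Fin N → ℝ) : ‖WithLp.toLp 2 y‖ ^ 2 = y ⬝ᵥ y := by
  rw [EuclideanSpace.real_norm_sq_eq]
  simp [dotProduct, pow_two]

lemma dotProduct_mulVec_sq_le (L : Matrix (Fin N) (Fin N) ℝ) (y f : Fin N → ℝ) :
    (y ⬝ᵥ L *ᵥ f) ^ 2 ≤ (y ⬝ᵥ y) * (specNorm L ^ 2 * (f ⬝ᵥ f)) := by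
  have h1 : y ⬝ᵥ L *ᵥ f = inner ℝ (WithLp.toLp 2 y) (WithLp.toLp 2 (L *ᵥ f)) := by
    rw [EuclideanSpace.inner_toLp_toLp, dotProduct_comm]
    simp
  have h2 : ‖WithLp.toLp 2 (L *ᵥ f)‖ ≤ specNorm L * ‖WithLp.toLp 2 f‖ := by
    rw [← toEuclideanCLM_toLp]
    exact ContinuousLinearMap.le_opNorm _ _
  have h3 : |y ⬝ᵥ L *ᵥ f| ≤ ‖WithLp.toLp 2 y‖ * (specNorm L * ‖WithLp.toLp 2 f‖) := by
    rw [h1]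
    exact (abs_real_inner_le_norm _ _).trans (mul_le_mul_of_nonneg_left h2 (norm_nonneg _))
  have := pow_le_pow_left₀ (abs_nonneg _) h3 2
  rwa [sq_abs, mul_pow, mul_pow, norm_toLp_sq, norm_toLp_sq] at this

lemma dotProduct_sq_le (y z : Fin N → ℝ) : (y ⬝ᵥ z) ^ 2 ≤ (y ⬝ᵥ y) * (z ⬝ᵥ z) := by
  have := Finset.sum_mul_sq_le_sq_mul_sq Finset.univ y z
  simpa [dotProduct, pow_two] using this

/-- The Lyapunov function of the disagreement dynamics. -/
def lyapunov (L : Matrix (Fin N) (Fin N) ℝ) (ε : ℝ) (X Y : Fin N → ℝ) : ℝ :=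
  Y ⬝ᵥ Y + X ⬝ᵥ L *ᵥ X + 2 * ε * (X ⬝ᵥ Y)

/-- Makes `lyapunov` comparable to the energy `|Y|² + X·LX`, within factors 1/2 and 3/2. -/
lemma abs_two_mul_dotProduct_le {μ ε : ℝ} (hε2 : ε ^ 2 ≤ μ / 4) {X Y : Fin N → ℝ}
    (hX : μ * (X ⬝ᵥ X) ≤ X ⬝ᵥ laplacian w *ᵥ X) (hw : IsConnectedUndirected w) :
    |2 * ε * (X ⬝ᵥ Y)| ≤ (Y ⬝ᵥ Y + X ⬝ᵥ laplacian w *ᵥ X) / 2 := by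
  have hp : 0 ≤ Y ⬝ᵥ Y := Finset.sum_nonneg fun i _ => mul_self_nonneg (Y i)
  have hq := dotProduct_laplacian_mulVec_nonneg hw X
  have hxx : 0 ≤ X ⬝ᵥ X := Finset.sum_nonneg fun i _ => mul_self_nonneg (X i)
  refine abs_le_of_sq_le_sq ?_ (by positivity)
  have h1 : (2 * ε * (X ⬝ᵥ Y)) ^ 2 ≤ μ * ((X ⬝ᵥ X) * (Y ⬝ᵥ Y)) := by
    have := mul_le_mul hε2 (dotProduct_sq_le X Y) (sq_nonneg _) (by nlinarith [sq_nonneg ε])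
    linarith
  have h2 := mul_le_mul_of_nonneg_right hX hp
  nlinarith [sq_nonneg (Y ⬝ᵥ Y - X ⬝ᵥ laplacian w *ᵥ X)]

/-- Damping alone dissipates only `Y`; the cross term adds `-2ε X·LX`. Positivity of `L` at `X + γ
Y` absorbs the mixed term `X·LY`, leaving `-ε (|Y|² + X·LX)` plus the input terms. Young's
inequality spends a quarter of that on the input, and the remaining `3ε/4` is just what `-(ε/2) V`
needs. -/
lemma lyapunov_deriv_le (hw : IsConnectedUndirected w) {μ γ ε : ℝ} (hμ : 0 < μ) (hγ : 0 < γ)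
    (hε : 0 < ε) (hε1 : 2 * ε ≤ γ * μ) (hε2 : 2 * (ε * γ) ≤ 1) {X Y f : Fin N → ℝ}
    (hX : μ * (X ⬝ᵥ X) ≤ X ⬝ᵥ laplacian w *ᵥ X) (hY : μ * (Y ⬝ᵥ Y) ≤ Y ⬝ᵥ laplacian w *ᵥ Y) :
    2 * (Y ⬝ᵥ -(laplacian w *ᵥ (X + γ • Y + f))) + 2 * (X ⬝ᵥ laplacian w *ᵥ Y) +
        2 * ε * (Y ⬝ᵥ Y + X ⬝ᵥ -(laplacian w *ᵥ (X + γ • Y + f))) ≤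
      -(ε / 2) * lyapunov (laplacian w) ε X Y +
        5 * (specNorm (laplacian w) ^ 2 * (f ⬝ᵥ f)) / ε := by
  -- The product of the two conditions on `ε`, divided by `γ`.
  have hεμ : ε ^ 2 ≤ μ / 4 := by
    have := mul_le_mul hε1 hε2 (by positivity) (by positivity)
    have h : γ * (4 * ε ^ 2) ≤ γ * μ := by linarith
    have := le_of_mul_le_mul_left h hγ
    linarith
  have hV := abs_two_mul_dotProduct_le (Y := Y) hεμ hX hw
  have hV' := (abs_le.1 hV).2
  have hg := dotProduct_mulVec_sq_le (laplacian w) Y f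
  have hh := dotProduct_mulVec_sq_le (laplacian w) X f
  have hYX := dotProduct_laplacian_mulVec_comm hw Y X
  have hc := dotProduct_laplacian_mulVec_nonneg hw (X + γ • Y)
  have hp : 0 ≤ Y ⬝ᵥ Y := Finset.sum_nonneg fun i _ => mul_self_nonneg (Y i)
  have hff : 0 ≤ f ⬝ᵥ f := Finset.sum_nonneg fun i _ => mul_self_nonneg (f i)
  have hq := dotProduct_laplacian_mulVec_nonneg hw X
  have hd := dotProduct_laplacian_mulVec_nonneg hw Y
  simp only [mulVec_add, mulVec_smul, dotProduct_add, add_dotProduct, dotProduct_smul,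
    smul_dotProduct, dotProduct_neg, smul_eq_mul, lyapunov] at *
  rw [hYX] at *
  set W := specNorm (laplacian w) ^ 2 * (f ⬝ᵥ f)
  have hW : 0 ≤ W := by positivity
  generalize Y ⬝ᵥ Y = p at *
  generalize X ⬝ᵥ X = xx at *
  generalize X ⬝ᵥ Y = k at *
  generalize X ⬝ᵥ laplacian w *ᵥ X = q at *
  generalize Y ⬝ᵥ laplacian w *ᵥ Y = d at *
  generalize X ⬝ᵥ laplacian w *ᵥ Y = c at *
  generalize Y ⬝ᵥ laplacian w *ᵥ f = g at *
  generalize X ⬝ᵥ laplacian w *ᵥ f = h at *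
  have e1 : -(2 * g) ≤ ε / 4 * p + 4 * W / ε := by
    have : |2 * g| ≤ ε / 4 * p + 4 * W / ε := by
      refine abs_le_of_sq_le_sq ?_ (by positivity)
      have : (ε / 4 * p + 4 * W / ε) ^ 2 = (ε / 4 * p - 4 * W / ε) ^ 2 + 4 * (p * W) := by
        field_simp
        ring
      nlinarith [sq_nonneg (ε / 4 * p - 4 * W / ε)]
    linarith [(abs_le.1 this).1]
  have e2 : -(2 * ε * h) ≤ ε / 4 * q + W / ε := by
    have : |2 * ε * h| ≤ ε / 4 * q + W / ε := by
      refine abs_le_of_sq_le_sq ?_ (by positivity)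
      have e : (ε / 4 * q + W / ε) ^ 2 = (ε / 4 * q - W / ε) ^ 2 + q * W := by
        field_simp
        ring
      have h1 : 4 * ε ^ 2 * h ^ 2 ≤ μ * (xx * W) := by
        have := mul_le_mul hεμ hh (sq_nonneg _) (by positivity)
        linarith
      have h2 := mul_le_mul_of_nonneg_right hX hW
      nlinarith [sq_nonneg (ε / 4 * q - W / ε)]
    linarith [(abs_le.1 this).1]
  have e3 : 0 ≤ ε * (q + γ * c + γ * (c + γ * d)) := mul_nonneg hε.le (by linarith)
  have e4 : 2 * (ε * γ) * (γ * d) ≤ 1 * (γ * d) :=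
    mul_le_mul_of_nonneg_right hε2 (by positivity)
  have e5 : γ * (μ * p) ≤ γ * d := mul_le_mul_of_nonneg_left hY hγ.le
  have e6 : 2 * ε * p ≤ γ * μ * p := mul_le_mul_of_nonneg_right hε1 hp
  have e7 : ε * (2 * ε * k) ≤ ε * ((p + q) / 2) := mul_le_mul_of_nonneg_left hV' hε.le
  have e8 : 5 * W / ε = 4 * W / ε + W / ε := by ring
  rw [e8]
  nlinarith

lemma hasDerivWithinAt_dotProduct {a b : ℝ → Fin N → ℝ} {a' b' : Fin N → ℝ} {S : Set ℝ} {s : ℝ}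
    (ha : ∀ i, HasDerivWithinAt (fun s => a s i) (a' i) S s)
    (hb : ∀ i, HasDerivWithinAt (fun s => b s i) (b' i) S s) :
    HasDerivWithinAt (fun s => a s ⬝ᵥ b s) (a' ⬝ᵥ b s + a s ⬝ᵥ b') S s := by
  simp only [dotProduct, ← Finset.sum_add_distrib]
  exact HasDerivWithinAt.fun_sum fun i _ => (ha i).mul (hb i)

lemma hasDerivWithinAt_mulVec (L : Matrix (Fin N) (Fin N) ℝ) {a : ℝ → Fin N → ℝ}
    {a' : Fin N → ℝ} {S : Set ℝ} {s : ℝ}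
    (ha : ∀ i, HasDerivWithinAt (fun s => a s i) (a' i) S s) (i : Fin N) :
    HasDerivWithinAt (fun s => (L *ᵥ a s) i) ((L *ᵥ a') i) S s := by
  simp only [mulVec, dotProduct]
  exact HasDerivWithinAt.fun_sum fun j _ => (ha j).const_mul (L i j)

lemma hasDerivWithinAt_lyapunov (hw : IsConnectedUndirected w) (ε : ℝ) {X Y : ℝ → Fin N → ℝ}
    {Z : Fin N → ℝ} {S : Set ℝ} {s : ℝ}
    (hX : ∀ i, HasDerivWithinAt (fun s => X s i) (Y s i) S s)
    (hY : ∀ i, HasDerivWithinAt (fun s => Y s i) (Z i) S s) :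
    HasDerivWithinAt (fun s => lyapunov (laplacian w) ε (X s) (Y s))
      (2 * (Y s ⬝ᵥ Z) + 2 * (X s ⬝ᵥ laplacian w *ᵥ Y s) +
        2 * ε * (Y s ⬝ᵥ Y s + X s ⬝ᵥ Z)) S s := by
  have := ((hasDerivWithinAt_dotProduct hY hY).add (hasDerivWithinAt_dotProduct hX
    (hasDerivWithinAt_mulVec (laplacian w) hX))).add
      ((hasDerivWithinAt_dotProduct hX hY).const_mul (2 * ε))
  refine this.congr_deriv ?_
  rw [dotProduct_comm Z, dotProduct_laplacian_mulVec_comm hw (Y s) (X s)]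
  ring

/-- Ultimate bound for the disagreement dynamics under a bounded input. -/
lemma eventually_lyapunov_le (hw : IsConnectedUndirected w) {μ γ ε c₀ c₁ α : ℝ} (hμ : 0 < μ)
    (hgap : ∀ x : Fin N → ℝ, ∑ i, x i = 0 → μ * (x ⬝ᵥ x) ≤ x ⬝ᵥ laplacian w *ᵥ x)
    (hγ : 0 < γ) (hε : 0 < ε) (hε1 : 2 * ε ≤ γ * μ) (hε2 : 2 * (ε * γ) ≤ 1) (hα : 0 < α)
    {X Y f : ℝ → Fin N → ℝ}
    (hXc : ∀ i, ContinuousOn (fun s => X s i) (Set.Ici 0))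
    (hYc : ∀ i, ContinuousOn (fun s => Y s i) (Set.Ici 0))
    (hX : ∀ s, 0 ≤ s → ∀ i, HasDerivWithinAt (fun s => X s i) (Y s i) (Set.Ici s) s)
    (hY : ∀ s, 0 ≤ s → ∀ i, HasDerivWithinAt (fun s => Y s i)
      ((-(laplacian w *ᵥ (X s + γ • Y s + f s))) i) (Set.Ici s) s)
    (hX0 : ∀ s, 0 ≤ s → ∑ i, X s i = 0) (hY0 : ∀ s, 0 ≤ s → ∑ i, Y s i = 0)
    (hf : ∀ s, 0 ≤ s → ∀ j, f s j ^ 2 ≤ 2 * (c₀ + c₁ * Real.exp (-α * s)) ^ 2)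
    {η : ℝ} (hη : 0 < η) :
    ∀ᶠ s in atTop, lyapunov (laplacian w) ε (X s) (Y s) ≤
      10 * (specNorm (laplacian w) ^ 2 * (2 * N * c₀ ^ 2)) / ε ^ 2 + η := by
  have hc : ContinuousOn (fun s => lyapunov (laplacian w) ε (X s) (Y s)) (Set.Ici 0) := by
    simp only [lyapunov, mulVec, dotProduct]
    fun_prop
  have hlim : Tendsto (fun s => 5 * (specNorm (laplacian w) ^ 2 *
      (2 * N * (c₀ + c₁ * Real.exp (-α * s)) ^ 2)) / ε) atTop
      (nhds (5 * (specNorm (laplacian w) ^ 2 * (2 * N * c₀ ^ 2)) / ε)) := by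
    have h1 : Tendsto (fun s => Real.exp (-α * s)) atTop (nhds 0) := by
      have h := Real.tendsto_exp_neg_atTop_nhds_zero.comp (tendsto_id.const_mul_atTop hα)
      refine h.congr fun s => ?_
      simp
    have h2 : Tendsto (fun s => c₀ + c₁ * Real.exp (-α * s)) atTop (nhds c₀) := by
      simpa using (h1.const_mul c₁).const_add c₀
    exact ((((h2.pow 2).const_mul (2 * (N : ℝ))).const_mul _).const_mul 5).div_const ε
  have := eventually_le_of_deriv_right_le (half_pos hε) hc
    (fun s hs => hasDerivWithinAt_lyapunov hw ε (hX s hs) (hY s hs)) (fun s hs => ?_) hlim hη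
  · refine this.mono fun s hs => hs.trans_eq ?_
    congr 1
    field_simp
    ring
  · refine (lyapunov_deriv_le hw hμ hγ hε hε1 hε2 (hgap _ (hX0 s hs)) (hgap _ (hY0 s hs))).trans ?_
    have : f s ⬝ᵥ f s ≤ 2 * N * (c₀ + c₁ * Real.exp (-α * s)) ^ 2 := by
      refine (Finset.sum_le_sum fun j _ => ((pow_two _).symm.trans_le (hf s hs j))).trans_eq ?_
      simp
      ring
    gcongr

end Lyapunov

namespace Execution

/-! ### From the Lyapunov bound to the disagreement vector. -/

section Disagreement

variable {N : ℕ} {x : Execution N} {w : Matrix (Fin N) (Fin N) ℝ} {γ c₀ c₁ α : ℝ}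

lemma IsTrajectory.continuousOn_Ici (hx : x.IsTrajectory w γ c₀ c₁ α) (hH : x.horizon = ⊤)
    (i : Fin N) : ContinuousOn (x.r i) (Set.Ici 0) ∧ ContinuousOn (x.v i) (Set.Ici 0) := by
  have h : Set.Ici (0 : ℝ) ⊆ {s : ℝ | 0 ≤ s ∧ (s : EReal) < x.horizon} := fun s hs =>
    ⟨hs, by rw [hH]; exact EReal.coe_lt_top s⟩
  exact ⟨(hx.cont_r i).mono h, (hx.cont_v i).mono h⟩

lemma IsTrajectory.sum_v_eq (hx : x.IsTrajectory w γ c₀ c₁ α) (hw : IsConnectedUndirected w)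
    (h₀ : 0 ≤ c₀) (h₁ : 0 ≤ c₁) (h₂ : 0 < c₀ + c₁) (hH : x.horizon = ⊤) {s : ℝ} (hs : 0 ≤ s) :
    ∑ i, x.v i s = ∑ i, x.v i 0 := by
  obtain ⟨f, hf⟩ := hx.exists_error_input h₀ h₁ h₂
  refine constant_of_has_deriv_right_zero (f := fun s => ∑ i, x.v i s) (a := 0) (b := s)
    (continuousOn_finsetSum _ fun i _ => (hx.continuousOn_Ici hH i).2.mono Set.Icc_subset_Ici_self)
    (fun t ht => ?_) s ⟨hs, le_rfl⟩
  have := HasDerivWithinAt.fun_sum fun i (_ : i ∈ Finset.univ) =>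
    (hf t ht.1 (by rw [hH]; exact EReal.coe_lt_top t)).1 i
  rwa [Finset.sum_neg_distrib, sum_laplacian_mulVec hw, neg_zero] at this

lemma IsTrajectory.sum_r_eq (hx : x.IsTrajectory w γ c₀ c₁ α) (hw : IsConnectedUndirected w)
    (h₀ : 0 ≤ c₀) (h₁ : 0 ≤ c₁) (h₂ : 0 < c₀ + c₁) (hH : x.horizon = ⊤) {s : ℝ} (hs : 0 ≤ s) :
    ∑ i, x.r i s = ∑ i, x.r i 0 + s * ∑ i, x.v i 0 := by
  have h := constant_of_has_deriv_right_zero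
    (f := fun s => ∑ i, x.r i s - s * ∑ i, x.v i 0) (a := 0) (b := s)
    ((continuousOn_finsetSum _ fun i _ =>
      (hx.continuousOn_Ici hH i).1.mono Set.Icc_subset_Ici_self).sub (by fun_prop))
    (fun t ht => ?_) s ⟨hs, le_rfl⟩
  · simp only [zero_mul, sub_zero] at h
    linarith
  · have h1 := HasDerivWithinAt.fun_sum fun i (_ : i ∈ Finset.univ) =>
      hx.deriv_r i t ht.1 (by rw [hH]; exact EReal.coe_lt_top t)
    have h2 := h1.sub (((hasDerivAt_id t).mul_const (∑ i, x.v i 0)).hasDerivWithinAt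
      (s := Set.Ici t))
    rw [hx.sum_v_eq hw h₀ h₁ h₂ hH ht.1, one_mul, sub_self] at h2
    exact h2

lemma norm_disagreement_sq (s : ℝ) :
    ‖x.disagreement s‖ ^ 2 =
      (fun i => x.r i s - (x.meanR + s * x.meanV)) ⬝ᵥ
          (fun i => x.r i s - (x.meanR + s * x.meanV)) +
        (fun i => x.v i s - x.meanV) ⬝ᵥ (fun i => x.v i s - x.meanV) := by
  rw [EuclideanSpace.real_norm_sq_eq, Fintype.sum_sum_type]
  simp [disagreement, dotProduct, pow_two]

lemma IsTrajectory.eventually_norm_disagreement_sq_le (hx : x.IsTrajectory w γ c₀ c₁ α)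
    (hw : IsConnectedUndirected w) (hN : 0 < N) (hγ : 0 < γ) (h₀ : 0 ≤ c₀) (h₁ : 0 ≤ c₁)
    (h₂ : 0 < c₀ + c₁) (hα : 0 < α) (hH : x.horizon = ⊤) {μ ε : ℝ} (hμ : 0 < μ)
    (hgap : ∀ x : Fin N → ℝ, ∑ i, x i = 0 → μ * (x ⬝ᵥ x) ≤ x ⬝ᵥ laplacian w *ᵥ x)
    (hε : 0 < ε) (hε1 : 2 * ε ≤ γ * μ) (hε2 : 2 * (ε * γ) ≤ 1) {η : ℝ} (hη : 0 < η) :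
    ∀ᶠ s in atTop, ‖x.disagreement s‖ ^ 2 ≤
      2 * (1 + 1 / μ) * (10 * (specNorm (laplacian w) ^ 2 * (2 * N * c₀ ^ 2)) / ε ^ 2) + η := by
  obtain ⟨f, hf⟩ := hx.exists_error_input h₀ h₁ h₂
  have hlt : ∀ s : ℝ, (s : EReal) < x.horizon := fun s => by rw [hH]; exact EReal.coe_lt_top s
  have hN' : (N : ℝ) ≠ 0 := by positivity
  set X : ℝ → Fin N → ℝ := fun s i => x.r i s - (x.meanR + s * x.meanV) with hXdef
  set Y : ℝ → Fin N → ℝ := fun s i => x.v i s - x.meanV with hYdef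
  -- Conservation of the mean velocity keeps `X` and `Y` in the zero-sum space, where the spectral
  -- gap applies.
  have hX0 : ∀ s, 0 ≤ s → ∑ i, X s i = 0 := by
    intro s hs
    simp only [hXdef, Finset.sum_sub_distrib, hx.sum_r_eq hw h₀ h₁ h₂ hH hs, meanR, meanV,
      Finset.sum_const, Finset.card_univ, Fintype.card_fin, nsmul_eq_mul]
    field_simp
    ring
  have hY0 : ∀ s, 0 ≤ s → ∑ i, Y s i = 0 := by
    intro s hs
    simp only [hYdef, Finset.sum_sub_distrib, hx.sum_v_eq hw h₀ h₁ h₂ hH hs, meanV,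
      Finset.sum_const, Finset.card_univ, Fintype.card_fin, nsmul_eq_mul]
    field_simp
    ring
  have hκ : 0 < 2 * (1 + 1 / μ) := by positivity
  have hV := eventually_lyapunov_le hw hμ hgap hγ hε hε1 hε2 hα (X := X) (Y := Y) (f := f)
    (c₀ := c₀) (c₁ := c₁)
    (fun i => (hx.continuousOn_Ici hH i).1.sub (by fun_prop))
    (fun i => (hx.continuousOn_Ici hH i).2.sub continuousOn_const)
    (fun s hs i => ?_) (fun s hs i => ?_) hX0 hY0 (fun s hs => (hf s hs (hlt s)).2)
    (div_pos hη hκ)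
  · filter_upwards [hV, eventually_ge_atTop 0] with s hs hs0
    have hgX := hgap _ (hX0 s hs0)
    have hεμ : ε ^ 2 ≤ μ / 4 := by
      have := mul_le_mul hε1 hε2 (by positivity) (by positivity)
      have h : γ * (4 * ε ^ 2) ≤ γ * μ := by linarith
      have := le_of_mul_le_mul_left h hγ
      linarith
    have hk := (abs_le.1 (abs_two_mul_dotProduct_le (Y := Y s) hεμ hgX hw)).1
    have hp : 0 ≤ Y s ⬝ᵥ Y s := Finset.sum_nonneg fun i _ => mul_self_nonneg (Y s i)
    have hq := dotProduct_laplacian_mulVec_nonneg hw (X s)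
    rw [norm_disagreement_sq]
    change X s ⬝ᵥ X s + Y s ⬝ᵥ Y s ≤ _
    have hx2 : X s ⬝ᵥ X s ≤ 1 / μ * (X s ⬝ᵥ laplacian w *ᵥ X s) := by
      rw [one_div, inv_mul_eq_div, le_div_iff₀ hμ]
      linarith
    have hE : X s ⬝ᵥ X s + Y s ⬝ᵥ Y s ≤ 2 * (1 + 1 / μ) * lyapunov (laplacian w) ε (X s) (Y s) := by
      have h3 : 0 ≤ 1 / μ * (Y s ⬝ᵥ Y s) := by positivity
      have h4 : (1 + 1 / μ) * (Y s ⬝ᵥ Y s + X s ⬝ᵥ laplacian w *ᵥ X s) ≤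
          (1 + 1 / μ) * (2 * lyapunov (laplacian w) ε (X s) (Y s)) := by
        refine mul_le_mul_of_nonneg_left ?_ (by positivity)
        rw [lyapunov]
        linarith
      linarith
    refine hE.trans ((mul_le_mul_of_nonneg_left hs hκ.le).trans_eq ?_)
    rw [mul_add, mul_div_cancel₀ _ hκ.ne']
  · have h := (hx.deriv_r i s hs (hlt s)).sub
      ((((hasDerivAt_id s).mul_const x.meanV).const_add x.meanR).hasDerivWithinAt
        (s := Set.Ici s))
    rw [one_mul] at h
    exact h
  · have h := ((hf s hs (hlt s)).1 i).sub_const x.meanV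
    refine h.congr_deriv ?_
    rw [Pi.neg_apply, laplacian_mulVec, laplacian_mulVec]
    congr 1
    refine Finset.sum_congr rfl fun j _ => ?_
    simp only [hXdef, hYdef, Pi.add_apply, Pi.smul_apply, smul_eq_mul]
    ring

end Disagreement

end Execution

end DoubleIntegrator

end

/-! ### Choice of the constants. -/

theorem mainTheorem7 (N : ℕ) (hN : 2 ≤ N) (w : Matrix (Fin N) (Fin N) ℝ)
    (hw : DoubleIntegrator.IsConnectedUndirected w) :
    (∃ cV : ℝ, 0 < cV ∧
      ∀ γ c₀ c₁ α : ℝ, 0 < γ → 0 ≤ c₀ → 0 ≤ c₁ → 0 < c₀ + c₁ → 0 < α →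
      ∀ x : DoubleIntegrator.Execution N, x.IsTrajectory w γ c₀ c₁ α → ¬ x.IsZeno →
      ∀ ε : ℝ, 0 < ε → ∀ᶠ s : ℝ in atTop,
        ‖x.disagreement s‖ ≤
          DoubleIntegrator.specNorm (DoubleIntegrator.laplacian w) * √(2 * (N : ℝ)) * c₀ * cV /
            DoubleIntegrator.absReLambda3
              (DoubleIntegrator.Gam γ (DoubleIntegrator.laplacian w)) + ε) ∧
    (∀ γ c₀ c₁ α : ℝ, 0 < γ → 0 ≤ c₀ → 0 ≤ c₁ → 0 < c₀ + c₁ →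
      (0 < c₀ ∨ (0 < α ∧ α < DoubleIntegrator.absReLambda3
        (DoubleIntegrator.Gam γ (DoubleIntegrator.laplacian w)))) →
      ∀ x : DoubleIntegrator.Execution N, x.IsTrajectory w γ c₀ c₁ α → ¬ x.IsZeno) := by
  refine ⟨?_, fun γ c₀ c₁ α hγ h₀ h₁ h₂ _ x hx => hx.not_isZeno hγ h₀ h₁ h₂⟩
  obtain ⟨μ, hμ, hgap⟩ := DoubleIntegrator.exists_spectral_gap hw
  obtain ⟨ν, hν, hlam⟩ := DoubleIntegrator.absReLambda3_Gam hw hN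
  -- The root is that of `2 (1 + 1/μ) * 10` from the bound on the squared disagreement; `ν / μ + 4`
  -- is the ratio allowed between `λ₃` and `ε`.
  refine ⟨√(20 * (1 + 1 / μ)) * (ν / μ + 4), by positivity, ?_⟩
  intro γ c₀ c₁ α hγ h₀ h₁ h₂ hα x hx hZ δ hδ
  have hH := DoubleIntegrator.Execution.horizon_eq_top_of_not_isZeno hZ
  obtain ⟨hpos, hle1, hle2⟩ := hlam γ hγ
  set Λ := DoubleIntegrator.specNorm (DoubleIntegrator.laplacian w)
  have hΛ : 0 ≤ Λ := norm_nonneg _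
  set ρ := DoubleIntegrator.absReLambda3
    (DoubleIntegrator.Gam γ (DoubleIntegrator.laplacian w))
  -- The choice is `ε = min (γμ, 1/γ) / 2`. Each of the two bounds on `λ₃` serves one case.
  obtain ⟨ε, hε, hε1, hε2, hρ⟩ : ∃ ε : ℝ, 0 < ε ∧ 2 * ε ≤ γ * μ ∧ 2 * (ε * γ) ≤ 1 ∧
      ρ ≤ (ν / μ + 4) * ε := by
    rcases le_total (γ * μ) (1 / γ) with h | h
    · refine ⟨γ * μ / 2, by positivity, by linarith, ?_, ?_⟩
      · rw [le_div_iff₀ hγ] at h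
        linarith
      · have e : (ν / μ + 4) * (γ * μ / 2) = γ * ν / 2 + 2 * (γ * μ) := by
          field_simp
          ring
        have : 0 < γ * μ := by positivity
        rw [e]
        linarith
    · refine ⟨1 / γ / 2, by positivity, by linarith, ?_, ?_⟩
      · field_simp
        exact le_rfl
      · have e : (ν / μ + 4) * (1 / γ / 2) = ν / μ * (1 / γ / 2) + 2 / γ := by
          field_simp
          ring
        have : 0 < ν / μ * (1 / γ / 2) := by positivity
        rw [e]
        linarith
  have hev := hx.eventually_norm_disagreement_sq_le hw (by omega) hγ h₀ h₁ h₂ hα hH hμ hgap hε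
    hε1 hε2 (pow_pos hδ 2)
  filter_upwards [hev] with s hs
  have hR : 0 ≤ Λ * √(2 * (N : ℝ)) * c₀ * (√(20 * (1 + 1 / μ)) * (ν / μ + 4)) / ρ := by positivity
  refine le_of_sq_le_sq ?_ (by positivity)
  set A := Λ * √(2 * (N : ℝ)) * c₀ * √(20 * (1 + 1 / μ)) with hA
  have hA0 : 0 ≤ A := by positivity
  have hAsq : A ^ 2 = 2 * (1 + 1 / μ) * (10 * (Λ ^ 2 * (2 * N * c₀ ^ 2))) := by
    rw [hA, mul_pow, mul_pow, mul_pow, Real.sq_sqrt (by positivity), Real.sq_sqrt (by positivity)]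
    ring
  have hR' : A / ε ≤ Λ * √(2 * (N : ℝ)) * c₀ * (√(20 * (1 + 1 / μ)) * (ν / μ + 4)) / ρ := by
    rw [div_le_div_iff₀ hε hpos]
    have := mul_le_mul_of_nonneg_left hρ hA0
    rw [hA] at this ⊢
    linarith
  have h5 : ‖x.disagreement s‖ ^ 2 ≤ (A / ε) ^ 2 + δ ^ 2 := by
    rw [div_pow, hAsq]
    refine hs.trans_eq ?_
    ring
  have h6 := pow_le_pow_left₀ (by positivity) hR' 2
  -- With `R` the claimed bound, `R² + δ² ≤ (R + δ)²`.
  nlinarith [mul_nonneg hR hδ.le]
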